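/- For $0<q\le\lambda<\infty$, the Morrey space $\mathcal M^\lambda_q(\mathbb R^n)$ consists of all $f\in L^1_{loc}(\mathbb R^n)$ with $$\|f\|_{\mathcal M^\lambda_q}:=\sup_Q |Q|^{1/\lambda-1/q}\Big(\int_Q|f(y)|^q\,dy\Big)^{1/q}<\infty,$$ where $Q$ runs over all (axis-parallel) cubes of positive side length. For $\varphi\in\mathcal S(\mathbb R^n)$ with $\int\varphi\neq0$ and $f\in\mathcal S'(\mathbb R^n)$ put $\varphi_t(x)=t^{-n}\varphi(x/t)$ and $M_\varphi f(x)=\sup_{t>0}|\varphi_t*f(x)|$. The Hardy-Morrey space $\mathcal{HM}^\lambda_q(\mathbb R^n)$ consists of all $f\in\mathcal S'(\mathbb R^n)$ such that $M_\varphi f\in\mathcal M^\lambda_q(\mathbb R^n)$ for some such $\varphi$. For a fixed such $\varphi$ write $\|f\|_{\mathcal{HM}^\lambda_q}:=\|M_\varphi f\|_{\mathcal M^\lambda_q}\in[0,\infty]$. A locally integrable function $g$ is identified with the tempered distribution $\psi\mapsto\int\psi g$ whenever $\psi g$ is integrable for all $\psi\in\mathcal S(\mathbb R^n)$. **Proposition.**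 (a) Let $1<q\le\lambda<\infty$. Every function in $\mathcal M^\lambda_q(\mathbb R^n)$ defines a tempered distribution, and $\mathcal{HM}^\lambda_q(\mathbb R^n)=\mathcal M^\lambda_q(\mathbb R^n)$ as subsets of $\mathcal S'(\mathbb R^n)$. For every $\varphi\in\mathcal S(\mathbb R^n)$ with $\int\varphi\ne0$ there are constants $c_1,c_2>0$, depending only on $n,q,\lambda,\varphi$, such that for all $f\in\mathcal M^\lambda_q(\mathbb R^n)$ $$c_1\|f\|_{\mathcal{HM}^\lambda_q}\le\|f\|_{\mathcal M^\lambda_q}\le c_2\|f\|_{\mathcal{HM}^\lambda_q}.$$ (b) Let $1\le\lambda<\infty$. Then $\mathcal{HM}^\lambda_1(\mathbb R^n)\hookrightarrow\mathcal M^\lambda_1(\mathbb R^n)$ continuously: for every $\varphi\in\mathcal S(\mathbb R^n)$ with $\int\varphi\neq0$ there is a constant $C>0$, depending only on $n,\lambda,\varphi$, such that every $f\in\mathcal{HM}^\lambda_1(\mathbb R^n)$ is (integration against) a function in $\mathcal M^\lambda_1(\mathbb R^n)$ and $\|f\|_{\mathcal M^\lambda_1}\le C\|f\|_{\mathcal{HM}^\lambda_1}$.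 -/

import Mathlib

open MeasureTheory Set SchwartzMap
open scoped ENNReal NNReal

namespace HardyMorrey

noncomputable section

/-- The closed axis-parallel cube in `ℝⁿ` with lower corner `a` and side length `ℓ`. -/
def cube {n : ℕ} (a : EuclideanSpace ℝ (Fin n)) (ℓ : ℝ) : Set (EuclideanSpace ℝ (Fin n)) :=
  {x | ∀ i, a i ≤ x i ∧ x i ≤ a i + ℓ}

/-- The Morrey functional `sup_Q |Q|^(1/lam - 1/q) (∫_Q |f|^q)^(1/q)`, with values in `[0, ∞]`,
the supremum being over all cubes of positive side length. The values of `f` are complex numbers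
or elements of `[0, ∞]` in what follows. -/
def morreyNorm {n : ℕ} {ε : Type*} [ENorm ε] (q lam : ℝ)
    (f : EuclideanSpace ℝ (Fin n) → ε) : ℝ≥0∞ :=
  ⨆ (a : EuclideanSpace ℝ (Fin n)) (ℓ : ℝ) (_ : 0 < ℓ),
    volume (cube a ℓ) ^ (1 / lam - 1 / q) * (∫⁻ y in cube a ℓ, ‖f y‖ₑ ^ q) ^ (1 / q)

/-- Membership of a function in the Morrey space: locally integrable (which includes
measurability up to null sets) with finite Morrey functional. -/
def MemMorrey {n : ℕ} {ε : Type*} [TopologicalSpace ε] [ContinuousENorm ε] (q lam : ℝ)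
    (f : EuclideanSpace ℝ (Fin n) → ε) : Prop :=
  LocallyIntegrable f volume ∧ morreyNorm q lam f < ∞

/-- The tempered distribution `f` is (integration against) the function `g`. -/
def IsRepresentedBy {n : ℕ} (f : 𝓢'(EuclideanSpace ℝ (Fin n), ℂ))
    (g : EuclideanSpace ℝ (Fin n) → ℂ) : Prop :=
  ∀ ψ : 𝓢(EuclideanSpace ℝ (Fin n), ℂ),
    Integrable (fun x => ψ x * g x) volume ∧ f ψ = ∫ x, ψ x * g x

/-- For `t > 0`, the Schwartz function `y ↦ φ_t (x - y)`, where `φ_t z = t^(-n) φ (z / t)`. -/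
def dilate {n : ℕ} (φ : 𝓢(EuclideanSpace ℝ (Fin n), ℂ)) {t : ℝ} (ht : 0 < t)
    (x : EuclideanSpace ℝ (Fin n)) : 𝓢(EuclideanSpace ℝ (Fin n), ℂ) :=
  ((t ^ n)⁻¹ : ℝ) • compSubConstCLM ℂ x (compCLMOfContinuousLinearEquiv ℂ
    (ContinuousLinearEquiv.smulLeft (R₁ := ℝ) (M₁ := EuclideanSpace ℝ (Fin n))
      (Units.mk0 (-t⁻¹) (neg_ne_zero.mpr (inv_ne_zero ht.ne')))) φ)

theorem dilate_apply {n : ℕ} (φ : 𝓢(EuclideanSpace ℝ (Fin n), ℂ)) {t : ℝ} (ht : 0 < t)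
    (x y : EuclideanSpace ℝ (Fin n)) :
    dilate φ ht x y = ((t ^ n)⁻¹ : ℝ) • φ (t⁻¹ • (x - y)) := by
  have h : (-t⁻¹) • (y - x) = t⁻¹ • (x - y) := by
    rw [neg_smul, ← smul_neg, neg_sub]
  simp [dilate, Units.smul_def, ← h]

/-- The convolution `φ_t * f (x)` of a tempered distribution with a dilated Schwartz function. -/
def conv {n : ℕ} (φ : 𝓢(EuclideanSpace ℝ (Fin n), ℂ)) {t : ℝ} (ht : 0 < t)
    (f : 𝓢'(EuclideanSpace ℝ (Fin n), ℂ)) (x : EuclideanSpace ℝ (Fin n)) : ℂ :=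
  f (dilate φ ht x)

/-- The smooth maximal function `M_φ f (x) = sup_{t > 0} |φ_t * f (x)|`, with values in
`[0, ∞]`. -/
def maximal {n : ℕ} (φ : 𝓢(EuclideanSpace ℝ (Fin n), ℂ))
    (f : 𝓢'(EuclideanSpace ℝ (Fin n), ℂ)) (x : EuclideanSpace ℝ (Fin n)) : ℝ≥0∞ :=
  ⨆ (t : ℝ) (ht : 0 < t), ‖conv φ ht f x‖ₑ

/-- The Hardy-Morrey functional `‖M_φ f‖` (Morrey norm of the maximal function) computed with
the Schwartz function `φ`. -/
def hardyMorreyNorm {n : ℕ} (φ : 𝓢(EuclideanSpace ℝ (Fin n), ℂ)) (q lam : ℝ)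
    (f : 𝓢'(EuclideanSpace ℝ (Fin n), ℂ)) : ℝ≥0∞ :=
  morreyNorm q lam (maximal φ f)

/-- Membership in the Hardy-Morrey space: `M_φ f` lies in the Morrey space for some Schwartz
function `φ` with nonzero integral. -/
def MemHardyMorrey {n : ℕ} (q lam : ℝ) (f : 𝓢'(EuclideanSpace ℝ (Fin n), ℂ)) : Prop :=
  ∃ φ : 𝓢(EuclideanSpace ℝ (Fin n), ℂ), (∫ x, φ x) ≠ 0 ∧ MemMorrey q lam (maximal φ f)

end

end HardyMorrey

open HardyMorrey

/-! Both inequalities come from pointwise comparisons between a function and a maximal function.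

Bounding `f` by `M_φ f`. As `t → 0`, `φ_t * f` tends to `(∫ φ) f` in the sense of distributions,
while `|φ_t * f| ≤ M_φ f` for every `t`. Hence `|∫ φ| |f ψ| ≤ ∫ |ψ| M_φ f` for every Schwartz `ψ`
(`enorm_integral_mul_enorm_apply_le`). If `M_φ f` has finite Morrey norm with `q ≥ 1`, Hölder's
inequality on cubes makes it integrable against `(1 + |y|)^(-(n+1))`, and the Riesz theorem in a
weighted `L²` space turns `f` into a function `g` (`exists_isRepresentedBy`). Testing with shrinking
bumps and Lebesgue differentiation give `|g| ≤ |∫ φ|⁻¹ M_φ f` almost everywhere. Nothing here needs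
`q > 1`, so this proves (b) and half of (a).

Bounding `M_φ f` by `f`. When `f` is a function `g`, the decay of `φ` gives `M_φ f ≤ C M g` with the
Hardy-Littlewood maximal function (`exists_maximal_le_hlMaximal`). For `q > 1` that operator is
bounded on Morrey spaces (`exists_morreyNorm_hlMaximal_le`): on a cube `Q`, the part of `g` inside
`3Q` is handled by the `L^q` inequality, and the rest meets `Q` only through balls larger than a
fixed fraction of `Q`, whose averages Hölder controls.

The convergence `φ_t * f → (∫ φ) f` rests on the symmetry of `∫ ψ(x) f(θ(· - x)) dx` in `ψ` and `θ`
(`integral_mul_apply_compSubConst_comm`). It is reached by writing `f` as a finite sum of bounded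
functionals on Banach spaces of bounded functions, where functionals commute with Bochner integrals.
-/

namespace HardyMorrey

/-! ### Translates of a Schwartz function paired with a tempered distribution -/

section Translation

open Filter Topology

variable {E : Type*} [NormedAddCommGroup E] [NormedSpace ℝ E]

theorem exists_decay_iteratedFDeriv (η : 𝓢(E, ℂ)) (k l : ℕ) :
    ∃ C : ℝ, 0 ≤ C ∧ ∀ x, (1 + ‖x‖) ^ k * ‖iteratedFDeriv ℝ l η x‖ ≤ C :=
  ⟨_, by positivity, fun x => one_add_le_sup_seminorm_apply (𝕜 := ℂ) (m := (k, l)) le_rfl le_rfl η x⟩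

theorem norm_pow_le_translate {E : Type*} [NormedAddCommGroup E] (x a : E) (k : ℕ) :
    ‖x‖ ^ k ≤ (1 + ‖a‖) ^ k * (1 + ‖x - a‖) ^ k := by
  rw [← mul_pow]
  have h : ‖x‖ ≤ ‖x - a‖ + ‖a‖ := by simpa using norm_add_le (x - a) a
  gcongr
  nlinarith [norm_nonneg a, norm_nonneg (x - a)]

theorem iteratedFDeriv_compSubConst (η : 𝓢(E, ℂ)) (l : ℕ) (a x : E) :
    iteratedFDeriv ℝ l (compSubConstCLM ℂ a η) x = iteratedFDeriv ℝ l η (x - a) :=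
  iteratedFDeriv_comp_sub l a x

theorem exists_seminorm_compSubConst_le (η : 𝓢(E, ℂ)) (k l : ℕ) :
    ∃ C : ℝ, 0 ≤ C ∧ ∀ a,
      SchwartzMap.seminorm ℂ k l (compSubConstCLM ℂ a η) ≤ C * (1 + ‖a‖) ^ k := by
  obtain ⟨C, hC, h⟩ := exists_decay_iteratedFDeriv η k l
  refine ⟨C, hC, fun a => seminorm_le_bound ℂ k l _ (by positivity) fun x => ?_⟩
  rw [iteratedFDeriv_compSubConst]
  calc ‖x‖ ^ k * ‖iteratedFDeriv ℝ l η (x - a)‖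
      ≤ (1 + ‖a‖) ^ k * (1 + ‖x - a‖) ^ k * ‖iteratedFDeriv ℝ l η (x - a)‖ := by
        gcongr; exact norm_pow_le_translate x a k
    _ = (1 + ‖a‖) ^ k * ((1 + ‖x - a‖) ^ k * ‖iteratedFDeriv ℝ l η (x - a)‖) := by ring
    _ ≤ C * (1 + ‖a‖) ^ k := by
        rw [mul_comm C]; gcongr; exact h _

/-- Mean value inequality for the `l`-th derivative on the segment from `x` to `x - a`. The factor
`‖a‖` makes translation continuous in the Schwartz topology. -/
theorem exists_seminorm_compSubConst_sub_le (η : 𝓢(E, ℂ)) (k l : ℕ) :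
    ∃ C : ℝ, 0 ≤ C ∧ ∀ a,
      SchwartzMap.seminorm ℂ k l (compSubConstCLM ℂ a η - η) ≤ C * (1 + ‖a‖) ^ k * ‖a‖ := by
  obtain ⟨C, hC, h⟩ := exists_decay_iteratedFDeriv η k (l + 1)
  refine ⟨C, hC, fun a => seminorm_le_bound ℂ k l _ (by positivity) fun x => ?_⟩
  have hd : iteratedFDeriv ℝ l (compSubConstCLM ℂ a η - η : 𝓢(E, ℂ)) x
      = iteratedFDeriv ℝ l η (x - a) - iteratedFDeriv ℝ l η x := by
    rw [← iteratedFDeriv_compSubConst]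
    exact iteratedFDeriv_sub_apply ((SchwartzMap.smooth _ l).contDiffAt)
      ((SchwartzMap.smooth _ l).contDiffAt)
  rw [hd]
  have hdiff : Differentiable ℝ (iteratedFDeriv ℝ l η) :=
    (η.smooth ⊤).differentiable_iteratedFDeriv (mod_cast ENat.natCast_lt_top l)
  -- The derivative bound used below has `‖x‖ ^ k` in its denominator.
  rcases eq_or_ne (‖x‖ ^ k) 0 with hx | hx
  · rw [hx, zero_mul]; positivity
  have hx' : 0 < ‖x‖ ^ k := lt_of_le_of_ne (by positivity) hx.symm
  have hmv := (convex_segment x (x - a)).norm_image_sub_le_of_norm_fderiv_le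
    (f := iteratedFDeriv ℝ l η) (C := C * (1 + ‖a‖) ^ k / ‖x‖ ^ k) (𝕜 := ℝ)
    (fun y _ => hdiff y) (fun y hy => ?_) (left_mem_segment ℝ _ _) (right_mem_segment ℝ _ _)
  · rw [sub_sub_cancel_left, norm_neg] at hmv
    calc _ ≤ ‖x‖ ^ k * (C * (1 + ‖a‖) ^ k / ‖x‖ ^ k * ‖a‖) := by gcongr
      _ = _ := by field_simp
  · rw [segment_eq_image'] at hy
    obtain ⟨s, ⟨hs0, hs1⟩, rfl⟩ := hy
    rw [norm_fderiv_iteratedFDeriv, le_div_iff₀ hx', mul_comm, sub_sub_cancel_left]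
    have e : x + s • -a = x - s • a := by rw [smul_neg, sub_eq_add_neg]
    dsimp only
    rw [e]
    have hsa : ‖s • a‖ ≤ ‖a‖ := by
      rw [norm_smul, Real.norm_of_nonneg hs0]
      exact mul_le_of_le_one_left (norm_nonneg _) hs1
    calc ‖x‖ ^ k * ‖iteratedFDeriv ℝ (l + 1) η (x - s • a)‖
        ≤ (1 + ‖s • a‖) ^ k * (1 + ‖x - s • a‖) ^ k
          * ‖iteratedFDeriv ℝ (l + 1) η (x - s • a)‖ := by
          gcongr; exact norm_pow_le_translate x _ k
    _ = (1 + ‖s • a‖) ^ k * ((1 + ‖x - s • a‖) ^ k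
          * ‖iteratedFDeriv ℝ (l + 1) η (x - s • a)‖) := by ring
    _ ≤ (1 + ‖a‖) ^ k * C := by gcongr; exact h (x - s • a)
    _ = _ := by ring

theorem continuous_compSubConst (η : 𝓢(E, ℂ)) :
    Continuous fun a : E => compSubConstCLM ℂ a η := by
  rw [continuous_iff_continuousAt]
  intro b
  rw [ContinuousAt, (schwartz_withSeminorms ℂ E ℂ).tendsto_nhds _ _]
  rintro ⟨k, l⟩ ε hε
  obtain ⟨C, hC, h⟩ := exists_seminorm_compSubConst_sub_le (compSubConstCLM ℂ b η) k l
  have ht : Tendsto (fun a : E => C * (1 + ‖a - b‖) ^ k * ‖a - b‖) (𝓝 b) (𝓝 0) := by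
    have : Continuous fun a : E => C * (1 + ‖a - b‖) ^ k * ‖a - b‖ := by fun_prop
    simpa using this.tendsto b
  filter_upwards [ht.eventually_lt_const hε] with a ha
  refine lt_of_le_of_lt ?_ ha
  have := h (a - b)
  rwa [compSubConstCLM_comp, add_sub_cancel] at this

theorem exists_norm_apply_le_sup_seminorm (f : 𝓢'(E, ℂ)) :
    ∃ (s : Finset (ℕ × ℕ)) (C : ℝ), 0 ≤ C ∧
      ∀ ψ, ‖f ψ‖ ≤ C * ∑ i ∈ s, SchwartzMap.seminorm ℂ i.1 i.2 ψ := by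
  obtain ⟨s, C, -, h⟩ := Seminorm.bound_of_continuous (schwartz_withSeminorms ℂ E ℂ)
    ((normSeminorm ℂ ℂ).comp (f : 𝓢(E, ℂ) →ₗ[ℂ] ℂ)) (by
      change Continuous fun ψ => ‖f ψ‖
      exact (ContinuousLinearMap.continuous f).norm)
  refine ⟨s, C, C.2, fun ψ => (h ψ).trans ?_⟩
  change (C : ℝ) * (s.sup (schwartzSeminormFamily ℂ E ℂ)) ψ ≤ _
  gcongr
  refine (Seminorm.finset_sup_le_sum _ _ ψ).trans (le_of_eq ?_)
  rw [← FunLike.coeAddMonoidHom_apply, map_sum, Finset.sum_apply]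
  rfl

/-- Polynomial growth supplies the integrable majorant when `t → 0` in `tendsto_integral_mul_conv`.
-/
theorem exists_norm_apply_compSubConst_le (f : 𝓢'(E, ℂ)) (η : 𝓢(E, ℂ)) :
    ∃ (C : ℝ) (k : ℕ), 0 ≤ C ∧ ∀ a, ‖f (compSubConstCLM ℂ a η)‖ ≤ C * (1 + ‖a‖) ^ k := by
  obtain ⟨s, C, hC, hf⟩ := exists_norm_apply_le_sup_seminorm f
  choose D hD h using exists_seminorm_compSubConst_le η
  refine ⟨C * ∑ i ∈ s, D i.1 i.2, ∑ i ∈ s, i.1,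
    mul_nonneg hC (Finset.sum_nonneg fun i _ => hD _ _), fun a => (hf _).trans ?_⟩
  rw [mul_assoc, Finset.sum_mul]
  gcongr with i hi
  refine (h _ _ a).trans ?_
  gcongr
  · exact hD _ _
  · linarith [norm_nonneg a]
  · exact Finset.single_le_sum (f := fun i : ℕ × ℕ => i.1) (fun _ _ => Nat.zero_le _) hi

theorem continuous_apply_compSubConst (f : 𝓢'(E, ℂ)) (η : 𝓢(E, ℂ)) :
    Continuous fun a : E => f (compSubConstCLM ℂ a η) :=
  (ContinuousLinearMap.continuous f).comp (continuous_compSubConst η)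

end Translation

/-! ### Symmetry of the smeared pairing of a distribution with translates -/

section Swap

open Filter Topology LineDeriv BoundedContinuousFunction

variable {E : Type*} [NormedAddCommGroup E] [NormedSpace ℝ E]

theorem lineDerivOp_lineDerivOp_comm (v w : E) (ψ : 𝓢(E, ℂ)) :
    ∂_{v} (∂_{w} ψ) = ∂_{w} (∂_{v} ψ) := by
  have key : ∀ (a b : E) (x : E), ∂_{a} (∂_{b} ψ) x = fderiv ℝ (fderiv ℝ ψ) x a b := by
    intro a b x
    rw [lineDerivOp_apply_eq_fderiv]
    have h : ((∂_{b} ψ : 𝓢(E, ℂ)) : E → ℂ) = fun y => fderiv ℝ ψ y b :=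
      funext fun y => lineDerivOp_apply_eq_fderiv b ψ y
    have hd : DifferentiableAt ℝ (fderiv ℝ ψ) x :=
      (((ψ.smooth 2).fderiv_right (m := 1) (by norm_num)).differentiable one_ne_zero) x
    rw [h, fderiv_clm_apply hd (differentiableAt_const b)]
    simp
  ext x
  rw [key, key]
  have : IsSymmSndFDerivAt ℝ ψ x := (ψ.smooth 2).contDiffAt.isSymmSndFDerivAt (by simp)
  exact this.eq v w

/-- Iterated integration by parts delivers the derivatives to the other factor in a different order;
this restores it. -/
theorem lineDerivOp_iteratedLineDerivOp_comm {l : ℕ} (v : E) (m : Fin l → E) (ψ : 𝓢(E, ℂ)) :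
    ∂_{v} (∂^{m} ψ) = ∂^{m} (∂_{v} ψ) := by
  induction l with
  | zero => simp
  | succ l ih =>
    rw [iteratedLineDerivOp_succ_left, lineDerivOp_lineDerivOp_comm, ih,
      ← iteratedLineDerivOp_succ_left]

/-- The Schwartz function `w ↦ ψ (y - w)`. -/
noncomputable def reflectAt (y : E) (ψ : 𝓢(E, ℂ)) : 𝓢(E, ℂ) :=
  compSubConstCLM ℂ y (compCLMOfContinuousLinearEquiv ℂ (ContinuousLinearEquiv.neg ℝ) ψ)

theorem reflectAt_apply (y : E) (ψ : 𝓢(E, ℂ)) (w : E) : reflectAt y ψ w = ψ (y - w) := by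
  simp [reflectAt]

theorem lineDerivOp_reflectAt (y v : E) (ψ : 𝓢(E, ℂ)) :
    ∂_{v} (reflectAt y ψ) = -reflectAt y (∂_{v} ψ) := by
  ext w
  rw [lineDerivOp_apply_eq_fderiv]
  have h : (reflectAt y ψ : E → ℂ) = fun w => ψ (y - w) := funext (reflectAt_apply y ψ)
  rw [h, _root_.neg_apply, reflectAt_apply, lineDerivOp_apply_eq_fderiv]
  have h1 : HasFDerivAt (fun w => ψ (y - w)) ((fderiv ℝ ψ (y - w)).comp
      (-ContinuousLinearMap.id ℝ E)) w :=
    (ψ.hasFDerivAt (y - w)).comp w ((hasFDerivAt_id w).const_sub y)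
  rw [h1.fderiv]
  simp

/-- If `‖f v‖ ≤ C ‖J v‖` then `f` factors through `J` and a continuous functional. -/
theorem exists_continuousLinearMap_comp_eq {V X : Type*} [AddCommGroup V] [Module ℂ V]
    [NormedAddCommGroup X] [NormedSpace ℂ X] (J : V →ₗ[ℂ] X) (f : V →ₗ[ℂ] ℂ) (C : ℝ)
    (h : ∀ v, ‖f v‖ ≤ C * ‖J v‖) : ∃ L : X →L[ℂ] ℂ, ∀ v, L (J v) = f v := by
  -- The estimate makes `f` vanish on the kernel of `J`, so `f` descends to a bounded functional on
  -- the range; Hahn-Banach extends it.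
  have hker : LinearMap.ker J ≤ LinearMap.ker f := fun v hv => by
    rw [LinearMap.mem_ker] at hv ⊢
    simpa [hv] using h v
  let g : LinearMap.range J →ₗ[ℂ] ℂ :=
    ((LinearMap.ker J).liftQ f hker) ∘ₗ (J.quotKerEquivRange.symm : _ →ₗ[ℂ] _)
  have hg : ∀ v, g ⟨J v, v, rfl⟩ = f v := fun v => by
    have : J.quotKerEquivRange.symm ⟨J v, v, rfl⟩ = Submodule.Quotient.mk v :=
      J.quotKerEquivRange_symm_apply_image v _
    simp [g, this]
  obtain ⟨L, hL, -⟩ := exists_extension_norm_eq (LinearMap.range J)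
    (g.mkContinuous C (by rintro ⟨_, v, rfl⟩; rw [hg]; exact h v))
  exact ⟨L, fun v => (hL ⟨J v, v, rfl⟩).trans (hg v)⟩

/-- If `‖f v‖ ≤ C ∑ i, ‖J i v‖` then `f` is a sum of continuous functionals of the `J i`. -/
theorem exists_sum_continuousLinearMap_comp_eq {V ι : Type*} [AddCommGroup V] [Module ℂ V]
    [Fintype ι] {X : ι → Type*} [∀ i, NormedAddCommGroup (X i)] [∀ i, NormedSpace ℂ (X i)]
    (J : ∀ i, V →ₗ[ℂ] X i) (f : V →ₗ[ℂ] ℂ) (C : ℝ) (hC : 0 ≤ C)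
    (h : ∀ v, ‖f v‖ ≤ C * ∑ i, ‖J i v‖) :
    ∃ L : ∀ i, X i →L[ℂ] ℂ, ∀ v, f v = ∑ i, L i (J i v) := by
  classical
  obtain ⟨L, hL⟩ := exists_continuousLinearMap_comp_eq (LinearMap.pi J) f (C * Fintype.card ι)
    fun v => (h v).trans (by
      rw [mul_assoc, ← nsmul_eq_mul]
      gcongr
      exact Finset.sum_le_card_nsmul _ _ _ fun i _ => norm_le_pi_norm (LinearMap.pi J v) i)
  refine ⟨fun i => L ∘L ContinuousLinearMap.single ℂ X i, fun v => ?_⟩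
  rw [← hL]
  conv_lhs => rw [← Finset.univ_sum_single (LinearMap.pi J v), map_sum]
  rfl

/-- Continuous `l`-multilinear forms, as a bare normed space. -/
def MultilinearForm (E : Type*) [NormedAddCommGroup E] [NormedSpace ℝ E] (l : ℕ) : Type _ :=
  ContinuousMultilinearMap ℝ (fun _ : Fin l => E) ℂ

namespace MultilinearForm

noncomputable instance (l : ℕ) : NormedAddCommGroup (MultilinearForm E l) :=
  inferInstanceAs (NormedAddCommGroup (ContinuousMultilinearMap ℝ (fun _ : Fin l => E) ℂ))

noncomputable instance (l : ℕ) : NormedSpace ℂ (MultilinearForm E l) :=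
  inferInstanceAs (NormedSpace ℂ (ContinuousMultilinearMap ℝ (fun _ : Fin l => E) ℂ))

noncomputable instance (l : ℕ) : NormedSpace ℝ (MultilinearForm E l) :=
  inferInstanceAs (NormedSpace ℝ (ContinuousMultilinearMap ℝ (fun _ : Fin l => E) ℂ))

instance (l : ℕ) : CompleteSpace (MultilinearForm E l) :=
  ContinuousMultilinearMap.instCompleteSpace (𝕜 := ℝ) (E := fun _ : Fin l => E) (F := ℂ)

/-- Evaluation at a tuple of vectors. -/
noncomputable def evalAt {l : ℕ} (m : Fin l → E) : MultilinearForm E l →L[ℝ] ℂ :=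
  ContinuousMultilinearMap.apply ℝ (fun _ : Fin l => E) ℂ m

/-- The `l`-th derivative at `x`. -/
noncomputable def iteratedDerivAt (l : ℕ) (ψ : E → ℂ) (x : E) : MultilinearForm E l :=
  iteratedFDeriv ℝ l ψ x

theorem norm_iteratedDerivAt (l : ℕ) (ψ : E → ℂ) (x : E) :
    ‖iteratedDerivAt l ψ x‖ = ‖iteratedFDeriv ℝ l ψ x‖ := rfl

end MultilinearForm

open MultilinearForm in
/-- The weighted derivative `x ↦ ‖x‖ ^ k • D^l ψ x` as a bounded continuous function. -/
noncomputable def weightedDeriv (k l : ℕ) :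
    𝓢(E, ℂ) →ₗ[ℂ] (E →ᵇ MultilinearForm E l) where
  toFun ψ := BoundedContinuousFunction.ofNormedAddCommGroup
    (fun x => ‖x‖ ^ k • iteratedDerivAt l ψ x)
    ((continuous_norm.pow k).smul ((ψ.smooth ⊤).continuous_iteratedFDeriv (mod_cast le_top)))
    (SchwartzMap.seminorm ℂ k l ψ) (fun x => by
      rw [norm_smul, norm_pow, norm_norm, norm_iteratedDerivAt]; exact le_seminorm ℂ k l ψ x)
  map_add' ψ η := by
    ext1 x
    change ‖x‖ ^ k • iteratedFDeriv ℝ l (ψ + η : 𝓢(E, ℂ)) x = _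
    have : iteratedFDeriv ℝ l (ψ + η : 𝓢(E, ℂ)) x
        = iteratedFDeriv ℝ l ψ x + iteratedFDeriv ℝ l η x :=
      iteratedFDeriv_add_apply (ψ.smooth l).contDiffAt (η.smooth l).contDiffAt
    rw [this, smul_add]
    rfl
  map_smul' c ψ := by
    ext1 x
    change ‖x‖ ^ k • iteratedFDeriv ℝ l (c • ψ : 𝓢(E, ℂ)) x = _
    have : iteratedFDeriv ℝ l (c • ψ : 𝓢(E, ℂ)) x = c • iteratedFDeriv ℝ l ψ x :=
      iteratedFDeriv_const_smul_apply (ψ.smooth l).contDiffAt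
    rw [this, smul_comm]
    rfl

theorem weightedDeriv_apply (k l : ℕ) (ψ : 𝓢(E, ℂ)) (x : E) :
    weightedDeriv k l ψ x = ‖x‖ ^ k • MultilinearForm.iteratedDerivAt l ψ x := rfl

open MultilinearForm in
theorem norm_weightedDeriv_le (k l : ℕ) (ψ : 𝓢(E, ℂ)) :
    ‖weightedDeriv k l ψ‖ ≤ SchwartzMap.seminorm ℂ k l ψ :=
  BoundedContinuousFunction.norm_ofNormedAddCommGroup_le _ (by positivity) fun x => by
    rw [norm_smul, norm_pow, norm_norm, norm_iteratedDerivAt]; exact le_seminorm ℂ k l ψ x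

open MultilinearForm in
-- With `norm_weightedDeriv_le`, the Schwartz seminorm is exactly a norm in a Banach space, so
-- seminorm bounds on `f` become norm bounds.
theorem seminorm_le_norm_weightedDeriv (k l : ℕ) (ψ : 𝓢(E, ℂ)) :
    SchwartzMap.seminorm ℂ k l ψ ≤ ‖weightedDeriv k l ψ‖ := by
  refine seminorm_le_bound ℂ k l ψ (by positivity) fun x => ?_
  have := (weightedDeriv k l ψ).norm_coe_le_norm x
  rwa [weightedDeriv_apply, norm_smul, norm_pow, norm_norm, norm_iteratedDerivAt] at this

theorem continuous_weightedDeriv (k l : ℕ) : Continuous (weightedDeriv (E := E) k l) := by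
  refine WithSeminorms.continuous_normedSpace_rng (𝕝₂ := ℂ)
    (E →ᵇ MultilinearForm E l) (schwartz_withSeminorms ℂ E ℂ)
    (weightedDeriv k l)
    ⟨{(k, l)}, 1, fun ψ => ?_⟩
  rw [one_smul, Finset.sup_singleton]
  exact norm_weightedDeriv_le k l ψ

variable [FiniteDimensional ℝ E] [MeasurableSpace E] [BorelSpace E]
  (μ : Measure E) [μ.IsAddHaarMeasure]

/-- The sign from each integration by parts cancels the sign from differentiating `w ↦ ψ (y - w)`.
-/
theorem integral_reflectAt_mul_iteratedLineDerivOp {l : ℕ} (m : Fin l → E) (ψ θ : 𝓢(E, ℂ)) (y : E) :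
    ∫ w, ψ (y - w) * (∂^{m} θ) w ∂μ = ∫ w, (∂^{m} ψ) (y - w) * θ w ∂μ := by
  induction l generalizing ψ θ with
  | zero => simp
  | succ l ih =>
    rw [iteratedLineDerivOp_succ_left m θ, iteratedLineDerivOp_succ_left m ψ,
      lineDerivOp_iteratedLineDerivOp_comm _ _ ψ, ← ih]
    have := integral_mul_lineDerivOp_right_eq_neg_left (μ := μ) (reflectAt y ψ)
      (∂^{Fin.tail m} θ) (m 0)
    rw [lineDerivOp_reflectAt] at this
    simpa only [_root_.neg_apply, reflectAt_apply, neg_mul, integral_neg, neg_neg] using this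

theorem integrable_one_add_norm_pow_mul (ψ : 𝓢(E, ℂ)) (k : ℕ) :
    Integrable (fun x => (1 + ‖x‖) ^ k * ‖ψ x‖) μ := by
  have h : Integrable (fun x => 2 ^ (k - 1) * (‖ψ x‖ + ‖x‖ ^ k * ‖ψ x‖)) μ :=
    (ψ.integrable.norm.add (ψ.integrable_pow_mul μ k)).const_mul _
  refine h.mono' (by fun_prop) (Eventually.of_forall fun x => ?_)
  rw [Real.norm_of_nonneg (by positivity)]
  calc (1 + ‖x‖) ^ k * ‖ψ x‖ ≤ 2 ^ (k - 1) * (1 ^ k + ‖x‖ ^ k) * ‖ψ x‖ := by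
        gcongr; exact add_pow_le zero_le_one (norm_nonneg _) k
    _ = _ := by ring

theorem integrable_smul_weightedDeriv_compSubConst (k l : ℕ) (η ξ : 𝓢(E, ℂ)) :
    Integrable (fun x => η x • weightedDeriv k l (compSubConstCLM ℂ x ξ)) μ := by
  obtain ⟨D, hD, h⟩ := exists_seminorm_compSubConst_le ξ k l
  refine ((integrable_one_add_norm_pow_mul μ η k).const_mul D).mono'
    (η.continuous.smul ((continuous_weightedDeriv k l).comp
      (continuous_compSubConst ξ))).aestronglyMeasurable (Eventually.of_forall fun x => ?_)
  rw [norm_smul, ← mul_assoc, mul_comm ‖η x‖]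
  gcongr
  exact (norm_weightedDeriv_le _ _ _).trans (h x)

/-- Evaluated at a point `y` and directions `m`, both sides are `‖y‖ ^ k` times the derivative `∂^m
(ψ * θ) (y)` of the convolution. -/
theorem integral_smul_weightedDeriv_compSubConst_comm (k l : ℕ) (ψ θ : 𝓢(E, ℂ)) :
    ∫ x, ψ x • weightedDeriv k l (compSubConstCLM ℂ x θ) ∂μ
      = ∫ x, θ x • weightedDeriv k l (compSubConstCLM ℂ x ψ) ∂μ := by
  refine BoundedContinuousFunction.ext fun y => ContinuousMultilinearMap.ext fun m => ?_
  let T : (E →ᵇ MultilinearForm E l) →L[ℝ] ℂ :=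
    (MultilinearForm.evalAt m) ∘L
      (BoundedContinuousFunction.evalCLM ℝ y)
  have hT : ∀ η ξ : 𝓢(E, ℂ), T (∫ x, η x • weightedDeriv k l (compSubConstCLM ℂ x ξ) ∂μ)
      = ‖y‖ ^ k • ∫ w, η (y - w) * (∂^{m} ξ) w ∂μ := by
    intro η ξ
    rw [← T.integral_comp_comm (integrable_smul_weightedDeriv_compSubConst μ k l η ξ),
      ← integral_sub_left_eq_self _ μ y, ← integral_smul]
    refine integral_congr_ae (Eventually.of_forall fun x => ?_)
    change η (y - x) • (‖y‖ ^ k • iteratedFDeriv ℝ l (compSubConstCLM ℂ (y - x) ξ) y m) = _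
    rw [iteratedFDeriv_compSubConst, sub_sub_cancel, smul_comm]
    simp only [iteratedLineDerivOp_eq_iteratedFDeriv, smul_eq_mul]
  refine (hT ψ θ).trans (Eq.trans ?_ (hT θ ψ).symm)
  rw [integral_reflectAt_mul_iteratedLineDerivOp]
  congr 1
  rw [← integral_sub_left_eq_self _ μ y]
  simp only [sub_sub_cancel, mul_comm]

/-- Both sides are the value of `f` at the convolution of `ψ` and `θ`. -/
theorem integral_mul_apply_compSubConst_comm (f : 𝓢'(E, ℂ)) (ψ θ : 𝓢(E, ℂ)) :
    ∫ x, ψ x * f (compSubConstCLM ℂ x θ) ∂μ = ∫ x, θ x * f (compSubConstCLM ℂ x ψ) ∂μ := by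
  obtain ⟨s, C, hC, hf⟩ := exists_norm_apply_le_sup_seminorm f
  obtain ⟨L, hL⟩ := exists_sum_continuousLinearMap_comp_eq
    (fun i : s => weightedDeriv (E := E) i.1.1 i.1.2) (f : 𝓢(E, ℂ) →ₗ[ℂ] ℂ) C hC fun η => by
      refine (hf η).trans ?_
      rw [← Finset.sum_coe_sort s]
      gcongr
      exact seminorm_le_norm_weightedDeriv _ _ η
  -- Each `L i` is bounded on a Banach space, hence commutes with the Bochner integral; the symmetry
  -- then follows from that of each weighted derivative.
  have hpull : ∀ η ξ : 𝓢(E, ℂ), ∫ x, η x * f (compSubConstCLM ℂ x ξ) ∂μ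
      = ∑ i : s, L i (∫ x, η x • weightedDeriv i.1.1 i.1.2 (compSubConstCLM ℂ x ξ) ∂μ) := by
    intro η ξ
    have hint := fun i : s => integrable_smul_weightedDeriv_compSubConst μ i.1.1 i.1.2 η ξ
    simp_rw [← fun i => (L i).integral_comp_comm (hint i)]
    rw [← integral_finsetSum _ fun i _ => (L i).integrable_comp (hint i)]
    refine integral_congr_ae (Eventually.of_forall fun x => ?_)
    dsimp only
    simp_rw [map_smul, ← Finset.smul_sum, ← hL, smul_eq_mul]
    rfl
  simp_rw [hpull, integral_smul_weightedDeriv_compSubConst_comm μ _ _ ψ θ]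

end Swap

/-! ### Duality bound of a distribution by its smooth maximal function -/

section Key

open Filter Topology

variable {n : ℕ}

theorem dilate_eq_compSubConst (φ : 𝓢(EuclideanSpace ℝ (Fin n), ℂ)) {t : ℝ} (ht : 0 < t)
    (x : EuclideanSpace ℝ (Fin n)) :
    dilate φ ht x = compSubConstCLM ℂ x (dilate φ ht 0) := by
  ext y
  rw [compSubConstCLM_apply, dilate_apply, dilate_apply, zero_sub, neg_sub]

theorem conv_eq (φ : 𝓢(EuclideanSpace ℝ (Fin n), ℂ)) {t : ℝ} (ht : 0 < t)
    (f : 𝓢'(EuclideanSpace ℝ (Fin n), ℂ)) (x : EuclideanSpace ℝ (Fin n)) :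
    conv φ ht f x = f (compSubConstCLM ℂ x (dilate φ ht 0)) := by
  rw [conv, dilate_eq_compSubConst]

theorem continuous_conv (φ : 𝓢(EuclideanSpace ℝ (Fin n), ℂ)) {t : ℝ} (ht : 0 < t)
    (f : 𝓢'(EuclideanSpace ℝ (Fin n), ℂ)) : Continuous (conv φ ht f) := by
  rw [funext fun x => conv_eq φ ht f x]
  exact continuous_apply_compSubConst f _

theorem measurable_maximal (φ : 𝓢(EuclideanSpace ℝ (Fin n), ℂ))
    (f : 𝓢'(EuclideanSpace ℝ (Fin n), ℂ)) : Measurable (maximal φ f) := by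
  refine LowerSemicontinuous.measurable ?_
  exact lowerSemicontinuous_iSup fun t => lowerSemicontinuous_iSup fun ht =>
    (continuous_conv φ ht f).enorm.lowerSemicontinuous

theorem enorm_conv_le_maximal (φ : 𝓢(EuclideanSpace ℝ (Fin n), ℂ)) {t : ℝ} (ht : 0 < t)
    (f : 𝓢'(EuclideanSpace ℝ (Fin n), ℂ)) (x : EuclideanSpace ℝ (Fin n)) :
    ‖conv φ ht f x‖ₑ ≤ maximal φ f x :=
  le_iSup₂ (f := fun (t : ℝ) (ht : 0 < t) => ‖conv φ ht f x‖ₑ) t ht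

/-- Swap the roles of `ψ` and the dilated `φ`, then substitute `x = -t z`. On the right `t` enters
only through the size of the translation, so the limit `t → 0` is a matter of dominated convergence.
-/
theorem integral_mul_conv (φ ψ : 𝓢(EuclideanSpace ℝ (Fin n), ℂ)) {t : ℝ} (ht : 0 < t)
    (f : 𝓢'(EuclideanSpace ℝ (Fin n), ℂ)) :
    ∫ x, ψ x * conv φ ht f x = ∫ z, φ z * f (compSubConstCLM ℂ ((-t) • z) ψ) := by
  simp_rw [conv_eq]
  rw [integral_mul_apply_compSubConst_comm]
  have h := Measure.integral_comp_smul (volume : Measure (EuclideanSpace ℝ (Fin n)))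
    (fun z => φ z * f (compSubConstCLM ℂ ((-t) • z) ψ)) (-t⁻¹)
  have hc : |((-t⁻¹) ^ Module.finrank ℝ (EuclideanSpace ℝ (Fin n)))⁻¹| = t ^ n := by
    rw [finrank_euclideanSpace_fin, abs_inv, abs_pow, abs_neg, abs_of_pos (inv_pos.2 ht),
      inv_pow, inv_inv]
  rw [hc, ← inv_smul_eq_iff₀ (by positivity), ← integral_smul] at h
  rw [← h]
  refine integral_congr_ae (Eventually.of_forall fun x => ?_)
  dsimp only
  rw [dilate_apply, zero_sub, smul_smul, neg_mul_neg, mul_inv_cancel₀ ht.ne', one_smul, smul_neg,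
    neg_smul, smul_mul_assoc]

theorem tendsto_integral_mul_conv (φ ψ : 𝓢(EuclideanSpace ℝ (Fin n), ℂ))
    (f : 𝓢'(EuclideanSpace ℝ (Fin n), ℂ)) :
    Tendsto (fun k : ℕ => ∫ x, ψ x * conv φ (Nat.one_div_pos_of_nat (α := ℝ) (n := k)) f x) atTop
      (𝓝 ((∫ z, φ z) * f ψ)) := by
  simp_rw [integral_mul_conv]
  rw [← integral_mul_const]
  obtain ⟨C, k, hC, hf⟩ := exists_norm_apply_compSubConst_le f ψ
  refine tendsto_integral_of_dominated_convergence (fun z => C * ((1 + ‖z‖) ^ k * ‖φ z‖))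
    (fun j => ?_) ((integrable_one_add_norm_pow_mul volume φ k).const_mul C) (fun j => ?_) ?_
  · exact (φ.continuous.mul ((continuous_apply_compSubConst f ψ).comp
      (continuous_const_smul _))).aestronglyMeasurable
  · refine Eventually.of_forall fun z => ?_
    -- Since `t = 1 / (j + 1) ≤ 1`, the majorant does not depend on `j`.
    have hj : ‖(-(1 / ((j : ℝ) + 1))) • z‖ ≤ ‖z‖ := by
      rw [norm_smul, norm_neg, Real.norm_of_nonneg (by positivity)]
      refine mul_le_of_le_one_left (norm_nonneg _) ?_
      rw [div_le_one (by positivity)]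
      linarith [j.cast_nonneg (α := ℝ)]
    calc ‖φ z * f (compSubConstCLM ℂ ((-(1 / ((j : ℝ) + 1))) • z) ψ)‖
        ≤ ‖φ z‖ * (C * (1 + ‖(-(1 / ((j : ℝ) + 1))) • z‖) ^ k) := by
          rw [norm_mul]; gcongr; exact hf _
      _ ≤ ‖φ z‖ * (C * (1 + ‖z‖) ^ k) := by gcongr
      _ = _ := by ring
  · refine Eventually.of_forall fun z => Tendsto.const_mul _ ?_
    have h0 : Tendsto (fun j : ℕ => (-(1 / ((j : ℝ) + 1))) • z) atTop (𝓝 0) := by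
      have := (tendsto_one_div_add_atTop_nhds_zero_nat (𝕜 := ℝ)).neg.smul_const z
      simpa using this
    have := ((continuous_apply_compSubConst f ψ).tendsto 0).comp h0
    simpa [Function.comp_def] using this

/-- Every `|φ_t * f|` is at most `M_φ f`, so the bound for `∫ ψ (φ_t * f)` survives the limit `t →
0`. It holds for an arbitrary tempered distribution. -/
theorem enorm_integral_mul_enorm_apply_le (φ ψ : 𝓢(EuclideanSpace ℝ (Fin n), ℂ))
    (f : 𝓢'(EuclideanSpace ℝ (Fin n), ℂ)) :
    ‖∫ z, φ z‖ₑ * ‖f ψ‖ₑ ≤ ∫⁻ x, ‖ψ x‖ₑ * maximal φ f x := by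
  rw [← enorm_mul]
  refine le_of_tendsto (tendsto_integral_mul_conv φ ψ f).enorm (Eventually.of_forall fun k => ?_)
  refine (enorm_integral_le_lintegral_enorm _).trans (lintegral_mono fun x => ?_)
  rw [enorm_mul]
  gcongr
  exact enorm_conv_le_maximal _ _ _ _

end Key

/-! ### Cubes, balls and Hölder's inequality -/

section Cubes

variable {n : ℕ}

theorem cube_eq_preimage (a : EuclideanSpace ℝ (Fin n)) (ℓ : ℝ) :
    cube a ℓ = WithLp.ofLp ⁻¹' Icc (WithLp.ofLp a) (fun i => a i + ℓ) := by
  ext x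
  simp [cube, Pi.le_def, forall_and]

theorem isClosed_cube (a : EuclideanSpace ℝ (Fin n)) (ℓ : ℝ) : IsClosed (cube a ℓ) := by
  rw [cube_eq_preimage]
  exact isClosed_Icc.preimage (PiLp.continuous_ofLp 2 _)

theorem measurableSet_cube (a : EuclideanSpace ℝ (Fin n)) (ℓ : ℝ) : MeasurableSet (cube a ℓ) :=
  (isClosed_cube a ℓ).measurableSet

theorem volume_cube (a : EuclideanSpace ℝ (Fin n)) (ℓ : ℝ) :
    volume (cube a ℓ) = ENNReal.ofReal ℓ ^ n := by
  rw [cube_eq_preimage, (PiLp.volume_preserving_ofLp (Fin n)).measure_preimage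
    measurableSet_Icc.nullMeasurableSet, Real.volume_Icc_pi]
  simp

theorem volume_cube_ne_zero (a : EuclideanSpace ℝ (Fin n)) {ℓ : ℝ} (hℓ : 0 < ℓ) :
    volume (cube a ℓ) ≠ 0 := by
  rw [volume_cube]; exact pow_ne_zero _ (by simpa using hℓ)

theorem volume_cube_ne_top (a : EuclideanSpace ℝ (Fin n)) (ℓ : ℝ) :
    volume (cube a ℓ) ≠ ∞ := by
  rw [volume_cube]; exact ENNReal.pow_ne_top ENNReal.ofReal_ne_top

theorem ball_subset_cube (x : EuclideanSpace ℝ (Fin n)) (r : ℝ) :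
    Metric.ball x r ⊆ cube (x - WithLp.toLp 2 fun _ => r) (2 * r) := by
  intro y hy i
  have h : |y i - x i| ≤ r := by
    have := PiLp.norm_apply_le (y - x) i
    rw [mem_ball_iff_norm] at hy
    rw [PiLp.sub_apply, Real.norm_eq_abs] at this
    exact this.trans hy.le
  rw [abs_le] at h
  simp only [PiLp.sub_apply]
  constructor <;> linarith [h.1, h.2]

theorem le_morreyNorm {ε : Type*} [ENorm ε] (q lam : ℝ) (f : EuclideanSpace ℝ (Fin n) → ε)
    (a : EuclideanSpace ℝ (Fin n)) {ℓ : ℝ} (hℓ : 0 < ℓ) :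
    volume (cube a ℓ) ^ (1 / lam - 1 / q) * (∫⁻ y in cube a ℓ, ‖f y‖ₑ ^ q) ^ (1 / q)
      ≤ morreyNorm q lam f :=
  le_iSup₂_of_le a ℓ (le_iSup_of_le hℓ le_rfl)

/-- Hölder's inequality on a cube, in terms of the Morrey functional. -/
theorem setLIntegral_cube_le {ε : Type*} [TopologicalSpace ε] [ContinuousENorm ε] {q lam : ℝ}
    (hq : 1 ≤ q) {f : EuclideanSpace ℝ (Fin n) → ε} (hf : AEStronglyMeasurable f volume)
    (a : EuclideanSpace ℝ (Fin n)) {ℓ : ℝ} (hℓ : 0 < ℓ) :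
    ∫⁻ y in cube a ℓ, ‖f y‖ₑ ≤ volume (cube a ℓ) ^ (1 - 1 / lam) * morreyNorm q lam f := by
  have h := eLpNorm'_le_eLpNorm'_mul_rpow_measure_univ (μ := volume.restrict (cube a ℓ)) zero_lt_one
    hq hf.restrict
  simp only [eLpNorm', ENNReal.rpow_one, div_one, Measure.restrict_apply_univ] at h
  refine h.trans ?_
  -- The Hölder exponent splits into the power in the conclusion and the Morrey weight.
  have e : (1 : ℝ) - 1 / q = (1 - 1 / lam) + (1 / lam - 1 / q) := by ring
  rw [e, ENNReal.rpow_add _ _ (volume_cube_ne_zero a hℓ) (volume_cube_ne_top a ℓ), mul_left_comm, mul_comm (_ ^ (1 / q))]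
  gcongr
  exact le_morreyNorm q lam f a hℓ

/-- For `2 * r ≥ 1` the circumscribed cube has volume at least one, so the exponent `1 - 1 / lam`
may be raised to `1`. -/
theorem setLIntegral_ball_le {ε : Type*} [TopologicalSpace ε] [ContinuousENorm ε] {q lam : ℝ}
    (hq : 1 ≤ q) (hlam : 1 ≤ lam)
    {f : EuclideanSpace ℝ (Fin n) → ε} (hf : AEStronglyMeasurable f volume)
    (x : EuclideanSpace ℝ (Fin n)) {r : ℝ} (hr : 1 ≤ 2 * r) :
    ∫⁻ y in Metric.ball x r, ‖f y‖ₑ ≤ ENNReal.ofReal (2 * r) ^ n * morreyNorm q lam f := by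
  refine (lintegral_mono_set (ball_subset_cube x r)).trans
    ((setLIntegral_cube_le (lam := lam) hq hf _ (by linarith)).trans ?_)
  rw [volume_cube]
  gcongr
  refine (ENNReal.rpow_le_rpow_of_exponent_le (y := 1 - 1 / lam) (z := 1) ?_ ?_).trans
    (ENNReal.rpow_one _).le
  · exact one_le_pow₀ (by simpa using ENNReal.ofReal_le_ofReal hr)
  · have : 0 ≤ 1 / lam := by positivity
    linarith

end Cubes

/-! ### Dyadic decomposition of a decaying kernel -/

section Decay

variable {E : Type*} [NormedAddCommGroup E]

/-- One term suffices: for the least `k` with `r < 2 ^ k`, either `k = 0`, or `r ≥ 2 ^ (k - 1)` and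
`(1 + r)⁻¹ ≤ 2 * 2⁻ᵏ`. -/
theorem inv_one_add_pow_le_tsum (m : ℕ) {r : ℝ} (hr : 0 ≤ r) :
    ENNReal.ofReal ((1 + r) ^ m)⁻¹
      ≤ 2 ^ m * ∑' k : ℕ, ((2 ^ m)⁻¹) ^ k * (if r < 2 ^ k then 1 else 0) := by
  classical
  have hex : ∃ k : ℕ, r < 2 ^ k := pow_unbounded_of_one_lt r one_lt_two
  have hterm := ENNReal.le_tsum (f := fun k : ℕ => ((2 ^ m : ℝ≥0∞)⁻¹) ^ k *
    (if r < 2 ^ k then 1 else 0)) (Nat.find hex)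
  refine le_trans ?_ (mul_le_mul_right hterm _)
  simp only [Nat.find_spec hex, if_true, mul_one]
  have h2 : (2 : ℝ≥0∞) ^ m * ((2 ^ m)⁻¹) ^ Nat.find hex
      = ENNReal.ofReal ((2 : ℝ) ^ m * ((2 ^ m)⁻¹) ^ Nat.find hex) := by
    rw [ENNReal.ofReal_mul (by positivity), ENNReal.ofReal_pow (by positivity),
      ENNReal.ofReal_pow (by positivity), ENNReal.ofReal_inv_of_pos (by positivity),
      ENNReal.ofReal_pow (by positivity)]
    simp
  rw [h2]
  refine ENNReal.ofReal_le_ofReal ?_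
  rw [← inv_pow, ← inv_pow, ← pow_mul, mul_comm m, pow_mul, ← mul_pow]
  gcongr
  rcases Nat.eq_zero_or_pos (Nat.find hex) with h0 | hpos
  · rw [h0, pow_zero, mul_one]
    have : (1 + r)⁻¹ ≤ 1 := inv_le_one_of_one_le₀ (by linarith)
    linarith
  · obtain ⟨j, hj⟩ : ∃ j, Nat.find hex = j + 1 := ⟨_, (Nat.succ_pred_eq_of_pos hpos).symm⟩
    have hlt : ¬ r < 2 ^ j := Nat.find_min hex (by omega)
    rw [hj, pow_succ', ← mul_assoc, mul_inv_cancel₀ two_ne_zero, one_mul, inv_pow]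
    gcongr
    linarith

variable [MeasurableSpace E] [BorelSpace E] [NormedSpace ℝ E]

/-- If a function grows at most like `R ^ n` over the balls around `x` of radius `2 ^ k t`, then
its integral against the kernel `(1 + |x - y| / t) ^ (-(n + 1))` is controlled. -/
theorem lintegral_decay_mul_le {μ : Measure E} {u : E → ℝ≥0∞} (hu : AEMeasurable u μ) (x : E)
    {t : ℝ} (ht : 0 < t) (n : ℕ) {A : ℝ≥0∞}
    (h : ∀ k : ℕ, ∫⁻ y in Metric.ball x (2 ^ k * t), u y ∂μ ≤ (2 ^ n) ^ k * A) :
    ∫⁻ y, ENNReal.ofReal ((1 + ‖t⁻¹ • (x - y)‖) ^ (n + 1))⁻¹ * u y ∂μ ≤ 2 ^ (n + 2) * A := by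
  have hball : ∀ (k : ℕ) (y : E), ‖t⁻¹ • (x - y)‖ < 2 ^ k ↔ y ∈ Metric.ball x (2 ^ k * t) := by
    intro k y
    rw [norm_smul, norm_inv, Real.norm_of_nonneg ht.le, inv_mul_lt_iff₀ ht, mem_ball_iff_norm',
      mul_comm]
  calc ∫⁻ y, ENNReal.ofReal ((1 + ‖t⁻¹ • (x - y)‖) ^ (n + 1))⁻¹ * u y ∂μ
      ≤ ∫⁻ y, 2 ^ (n + 1) * ∑' k : ℕ, ((2 ^ (n + 1))⁻¹) ^ k *
          (Metric.ball x (2 ^ k * t)).indicator u y ∂μ := by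
        refine lintegral_mono fun y => ?_
        refine (mul_le_mul_left (inv_one_add_pow_le_tsum (n + 1)
          (norm_nonneg (t⁻¹ • (x - y)))) (u y)).trans (le_of_eq ?_)
        rw [mul_assoc, ← ENNReal.tsum_mul_right]
        congr 2
        funext k
        by_cases hk : ‖t⁻¹ • (x - y)‖ < 2 ^ k
        · rw [if_pos hk, indicator_of_mem ((hball k y).1 hk), mul_one]
        · rw [if_neg hk, indicator_of_notMem (mt (hball k y).2 hk)]; simp
    _ = 2 ^ (n + 1) * ∑' k : ℕ, ((2 ^ (n + 1))⁻¹) ^ k *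
          ∫⁻ y in Metric.ball x (2 ^ k * t), u y ∂μ := by
        have hm : ∀ k : ℕ, AEMeasurable ((Metric.ball x (2 ^ k * t)).indicator u) μ :=
          fun k => hu.indicator measurableSet_ball
        rw [lintegral_const_mul' _ _ (by simp), lintegral_tsum fun k => (hm k).const_mul _]
        congr 2
        funext k
        rw [lintegral_const_mul'' _ (hm k), lintegral_indicator measurableSet_ball]
    -- Decay of order `n + 1` beats growth of order `n` by a factor `1 / 2` per shell; the geometric
    -- sum then contributes the last factor `2`.
    _ ≤ 2 ^ (n + 1) * ∑' k : ℕ, (2⁻¹) ^ k * A := by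
        refine mul_le_mul_right (ENNReal.tsum_le_tsum fun k => ?_) _
        refine (mul_le_mul_right (h k) _).trans (le_of_eq ?_)
        rw [← mul_assoc, ← mul_pow, pow_succ, ENNReal.mul_inv (by simp) (by simp),
          mul_right_comm, ENNReal.inv_mul_cancel (by simp) (by simp), one_mul]
    _ = 2 ^ (n + 2) * A := by
        rw [ENNReal.tsum_mul_right, ENNReal.tsum_geometric, ENNReal.one_sub_inv_two, inv_inv,
          ← mul_assoc, ← pow_succ]

end Decay

/-! ### Moderate growth and monotonicity of Morrey functions -/

section Growth

variable {n : ℕ}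

theorem lintegral_decay_mul_enorm_lt_top {ε : Type*} [TopologicalSpace ε] [ContinuousENorm ε]
    {q lam : ℝ} (hq : 1 ≤ q) (hlam : 1 ≤ lam) {f : EuclideanSpace ℝ (Fin n) → ε}
    (hf : AEStronglyMeasurable f volume) (hN : morreyNorm q lam f < ∞) :
    ∫⁻ y, ENNReal.ofReal ((1 + ‖y‖) ^ (n + 1))⁻¹ * ‖f y‖ₑ < ∞ := by
  have h := lintegral_decay_mul_le hf.enorm 0 one_pos n
    (A := 2 ^ n * morreyNorm q lam f) fun k => by
      rw [mul_one]
      refine (setLIntegral_ball_le (lam := lam) hq hlam hf 0 ?_).trans (le_of_eq ?_)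
      · have : (1 : ℝ) ≤ 2 ^ k := one_le_pow₀ one_le_two
        linarith
      · rw [ENNReal.ofReal_mul zero_le_two, ENNReal.ofReal_pow zero_le_two, ENNReal.ofReal_ofNat]
        ring
  simp only [inv_one, one_smul, zero_sub, norm_neg] at h
  refine h.trans_lt ?_
  exact ENNReal.mul_lt_top (by simp) (ENNReal.mul_lt_top (by simp) hN)

theorem locallyIntegrable_of_morreyNorm_lt_top {ε : Type*} [TopologicalSpace ε]
    [ContinuousENorm ε] [TopologicalSpace.PseudoMetrizableSpace ε]
    {q lam : ℝ} (hq : 1 ≤ q) (hlam : 1 ≤ lam) {f : EuclideanSpace ℝ (Fin n) → ε}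
    (hf : AEStronglyMeasurable f volume) (hN : morreyNorm q lam f < ∞) :
    LocallyIntegrable f volume := by
  intro x
  refine ⟨Metric.ball x 1, Metric.ball_mem_nhds x one_pos, hf.restrict, ?_⟩
  exact (setLIntegral_ball_le (lam := lam) hq hlam hf x (by norm_num)).trans_lt
    (ENNReal.mul_lt_top (by simp) hN)

theorem morreyNorm_le_of_ae_le {ε ε' : Type*} [ENorm ε] [ENorm ε'] {q lam : ℝ} (hq : 0 < q)
    {f : EuclideanSpace ℝ (Fin n) → ε} {g : EuclideanSpace ℝ (Fin n) → ε'} {c : ℝ≥0}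
    (h : ∀ᵐ x, ‖f x‖ₑ ≤ c * ‖g x‖ₑ) : morreyNorm q lam f ≤ c * morreyNorm q lam g := by
  refine iSup₂_le fun a ℓ => iSup_le fun hℓ => ?_
  calc volume (cube a ℓ) ^ (1 / lam - 1 / q) * (∫⁻ y in cube a ℓ, ‖f y‖ₑ ^ q) ^ (1 / q)
      ≤ volume (cube a ℓ) ^ (1 / lam - 1 / q) *
          (∫⁻ y in cube a ℓ, (c : ℝ≥0∞) ^ q * ‖g y‖ₑ ^ q) ^ (1 / q) := by
        gcongr 1
        refine ENNReal.rpow_le_rpow (lintegral_mono_ae ((ae_restrict_of_ae h).mono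
          fun y hy => ?_)) (by positivity)
        rw [← ENNReal.mul_rpow_of_nonneg _ _ hq.le]
        exact ENNReal.rpow_le_rpow hy hq.le
    _ = c * (volume (cube a ℓ) ^ (1 / lam - 1 / q) *
          (∫⁻ y in cube a ℓ, ‖g y‖ₑ ^ q) ^ (1 / q)) := by
        rw [lintegral_const_mul' _ _ (ENNReal.rpow_ne_top_of_nonneg hq.le ENNReal.coe_ne_top),
          ENNReal.mul_rpow_of_nonneg _ _ (by positivity), ← ENNReal.rpow_mul,
          mul_one_div_cancel hq.ne', ENNReal.rpow_one, mul_left_comm]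
    _ ≤ c * morreyNorm q lam g := by
        gcongr
        exact le_morreyNorm q lam g a hℓ

end Growth

/-! ### From dominated distributions to functions, and pointwise domination -/

section Representation

open Filter Topology

variable {n : ℕ}

/-- A tempered distribution dominated by a measure of moderate growth is a function. -/
theorem exists_isRepresentedBy {f : 𝓢'(EuclideanSpace ℝ (Fin n), ℂ)}
    {m : EuclideanSpace ℝ (Fin n) → ℝ≥0∞} (hm : Measurable m) {N : ℕ}
    (hfin : ∫⁻ y, ENNReal.ofReal ((1 + ‖y‖) ^ N)⁻¹ * m y < ∞) {c : ℝ≥0}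
    (h : ∀ ψ : 𝓢(EuclideanSpace ℝ (Fin n), ℂ), ‖f ψ‖ₑ ≤ c * ∫⁻ x, ‖ψ x‖ₑ * m x) :
    ∃ g : EuclideanSpace ℝ (Fin n) → ℂ, IsRepresentedBy f g := by
  set d : EuclideanSpace ℝ (Fin n) → ℝ≥0∞ := fun y => ENNReal.ofReal ((1 + ‖y‖) ^ N)⁻¹ * m y
    with hd
  have hdm : Measurable d := by fun_prop
  have hdlt : ∀ᵐ y, d y < ∞ := ae_lt_top hdm hfin.ne
  -- Moving the weight into the measure makes `μ` finite, and multiplying `ψ` by the inverse weight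
  -- `W` keeps it bounded. Then `ψ W` lies in `L²(μ)`, and `∫ |ψ| m` is its `L¹(μ)` norm.
  set μ : Measure (EuclideanSpace ℝ (Fin n)) := volume.withDensity d with hμ
  have : IsFiniteMeasure μ := isFiniteMeasure_withDensity hfin.ne
  let W : EuclideanSpace ℝ (Fin n) → ℂ := fun y => (((1 + ‖y‖) ^ N : ℝ) : ℂ)
  have hW : Continuous W := by fun_prop
  have hWn : ∀ y, ‖W y‖ = (1 + ‖y‖) ^ N := fun y => by
    simp only [W, Complex.norm_real]
    exact Real.norm_of_nonneg (by positivity)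
  have hmem : ∀ ψ : 𝓢(EuclideanSpace ℝ (Fin n), ℂ), MemLp (fun y => ψ y * W y) 2 μ := by
    intro ψ
    obtain ⟨C, hC, hb⟩ := exists_decay_iteratedFDeriv ψ N 0
    refine MemLp.of_bound (ψ.continuous.mul hW).aestronglyMeasurable C
      (Eventually.of_forall fun y => ?_)
    have := hb y
    rw [norm_iteratedFDeriv_zero] at this
    rwa [norm_mul, hWn, mul_comm]
  let J : 𝓢(EuclideanSpace ℝ (Fin n), ℂ) →ₗ[ℂ] Lp ℂ 2 μ :=
    { toFun := fun ψ => (hmem ψ).toLp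
      map_add' := fun ψ η => by
        rw [← MemLp.toLp_add]
        exact MemLp.toLp_congr _ _ (Eventually.of_forall fun y => by simp [add_mul])
      map_smul' := fun a ψ => by
        rw [RingHom.id_apply, ← MemLp.toLp_const_smul]
        exact MemLp.toLp_congr _ _ (Eventually.of_forall fun y => by simp [mul_assoc]) }
  have hJ : ∀ ψ, (J ψ : EuclideanSpace ℝ (Fin n) → ℂ) =ᵐ[μ] fun y => ψ y * W y := fun ψ =>
    (hmem ψ).coeFn_toLp
  -- Cauchy-Schwarz on the finite measure `μ` trades the `L¹` bound for an `L²` one, where the Riesz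
  -- theorem for Hilbert spaces applies.
  have hbound : ∀ ψ, ‖f ψ‖ ≤ (c * (μ univ ^ (1 / 2 : ℝ)).toReal) * ‖J ψ‖ := by
    intro ψ
    have h1 : ∫⁻ x, ‖ψ x‖ₑ * m x = eLpNorm (fun y => ψ y * W y) 1 μ := by
      rw [eLpNorm_one_eq_lintegral_enorm, hμ, lintegral_withDensity_eq_lintegral_mul _ hdm
        (show Measurable fun y => ‖ψ y * W y‖ₑ from (ψ.continuous.mul hW).enorm.measurable)]
      refine lintegral_congr fun y => ?_
      have hy : ‖W y‖ₑ = ENNReal.ofReal ((1 + ‖y‖) ^ N) := by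
        rw [← ofReal_norm, hWn]
      have hp : 0 < (1 + ‖y‖) ^ N := by positivity
      rw [Pi.mul_apply, enorm_mul, hy, hd]
      dsimp only
      rw [ENNReal.ofReal_inv_of_pos hp]
      have hc := ENNReal.inv_mul_cancel (a := ENNReal.ofReal ((1 + ‖y‖) ^ N)) (by simpa using hp)
        ENNReal.ofReal_ne_top
      calc ‖ψ y‖ₑ * m y = ((ENNReal.ofReal ((1 + ‖y‖) ^ N))⁻¹ * ENNReal.ofReal ((1 + ‖y‖) ^ N))
            * (‖ψ y‖ₑ * m y) := by rw [hc, one_mul]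
        _ = _ := by ring
    have h2 := eLpNorm_le_eLpNorm_mul_rpow_measure_univ (μ := μ) (p := 1) (q := 2) (by norm_num)
      (hmem ψ).1
    have h3 : ‖f ψ‖ₑ ≤ c * (‖J ψ‖ₑ * μ univ ^ (1 / 2 : ℝ)) := by
      refine (h ψ).trans ?_
      rw [h1]
      gcongr
      refine h2.trans (le_of_eq ?_)
      congr 1
      · exact (Lp.enorm_toLp (hf := hmem ψ)).symm
      · norm_num
    have h4 := ENNReal.toReal_mono (ENNReal.mul_ne_top ENNReal.coe_ne_top
      (ENNReal.mul_ne_top enorm_ne_top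
        (ENNReal.rpow_ne_top_of_nonneg (by norm_num) (measure_ne_top μ _)))) h3
    rw [ENNReal.toReal_mul, ENNReal.toReal_mul, toReal_enorm, toReal_enorm,
      ENNReal.coe_toReal] at h4
    linarith
  obtain ⟨L, hL⟩ := exists_continuousLinearMap_comp_eq J
    (f : 𝓢(EuclideanSpace ℝ (Fin n), ℂ) →ₗ[ℂ] ℂ) _ hbound
  let v : Lp ℂ 2 μ := (InnerProductSpace.toDual ℂ (Lp ℂ 2 μ)).symm L
  have hv : ∀ ψ, f ψ = ∫ y, inner ℂ (v y) (J ψ y) ∂μ := by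
    intro ψ
    rw [← L2.inner_def, InnerProductSpace.toDual_symm_apply]
    exact (hL ψ).symm
  refine ⟨fun y => (d y).toReal • (W y * (starRingEnd ℂ) (v y)), fun ψ => ?_⟩
  have e1 : (fun y => inner ℂ (v y) (J ψ y)) =ᵐ[μ]
      fun y => ψ y * (W y * (starRingEnd ℂ) (v y)) := by
    filter_upwards [hJ ψ] with y hy
    rw [hy, RCLike.inner_apply]
    ring
  have hi : Integrable (fun y => ψ y * (W y * (starRingEnd ℂ) (v y))) μ :=
    (L2.integrable_inner v (J ψ)).congr e1
  have e2 : (fun y => ψ y * ((d y).toReal • (W y * (starRingEnd ℂ) (v y))))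
      = fun y => (d y).toReal • (ψ y * (W y * (starRingEnd ℂ) (v y))) :=
    funext fun y => by rw [mul_smul_comm]
  rw [e2]
  refine ⟨(integrable_withDensity_iff_integrable_smul' hdm hdlt).1 hi, ?_⟩
  rw [hv, integral_congr_ae e1]
  exact integral_withDensity_eq_integral_toReal_smul hdm hdlt _

/-- A smooth bump of integral one around `x`, as a Schwartz function. -/
noncomputable def bumpAt (b : ContDiffBump (0 : EuclideanSpace ℝ (Fin n)))
    (x : EuclideanSpace ℝ (Fin n)) : 𝓢(EuclideanSpace ℝ (Fin n), ℂ) :=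
  reflectAt x (HasCompactSupport.toSchwartzMap (f := fun y => ((b.normed volume y : ℝ) : ℂ))
    (b.hasCompactSupport_normed.comp_left (g := ((↑) : ℝ → ℂ)) rfl)
    (Complex.ofRealCLM.contDiff.comp b.contDiff_normed))

theorem bumpAt_apply (b : ContDiffBump (0 : EuclideanSpace ℝ (Fin n)))
    (x y : EuclideanSpace ℝ (Fin n)) :
    bumpAt b x y = ((b.normed volume (x - y) : ℝ) : ℂ) := by
  rw [bumpAt, reflectAt_apply]
  rfl

theorem exists_integral_ne_zero :
    ∃ φ : 𝓢(EuclideanSpace ℝ (Fin n), ℂ), (∫ x, φ x) ≠ 0 := by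
  let b : ContDiffBump (0 : EuclideanSpace ℝ (Fin n)) := ⟨1, 2, one_pos, one_lt_two⟩
  refine ⟨bumpAt b 0, ?_⟩
  simp_rw [bumpAt_apply]
  rw [integral_sub_left_eq_self (fun y => ((b.normed volume y : ℝ) : ℂ)) volume 0,
    integral_complex_ofReal, b.integral_normed]
  simp

theorem IsRepresentedBy.locallyIntegrable {f : 𝓢'(EuclideanSpace ℝ (Fin n), ℂ)}
    {g : EuclideanSpace ℝ (Fin n) → ℂ} (h : IsRepresentedBy f g) :
    LocallyIntegrable g volume := by
  intro x
  let b : ContDiffBump x := ⟨1, 2, one_pos, one_lt_two⟩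
  let ψ : 𝓢(EuclideanSpace ℝ (Fin n), ℂ) :=
    HasCompactSupport.toSchwartzMap (f := fun y => ((b y : ℝ) : ℂ))
    (b.hasCompactSupport.comp_left (g := ((↑) : ℝ → ℂ)) rfl)
    (Complex.ofRealCLM.contDiff.comp b.contDiff)
  refine ⟨Metric.closedBall x 1, Metric.closedBall_mem_nhds x one_pos, ?_⟩
  refine ((h ψ).1.integrableOn (s := Metric.closedBall x 1)).congr_fun (fun y hy => ?_)
    Metric.isClosed_closedBall.measurableSet
  have : ψ y = 1 := by
    change ((b y : ℝ) : ℂ) = 1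
    rw [b.one_of_mem_closedBall hy, Complex.ofReal_one]
  simp [this]

/-- Take for `ψ` normalized bumps shrinking to `x`; by Lebesgue differentiation both sides converge
to the values at almost every `x`. -/
theorem ae_enorm_le_of_forall_enorm_integral_le {g : EuclideanSpace ℝ (Fin n) → ℂ}
    (hg : LocallyIntegrable g volume) {m : EuclideanSpace ℝ (Fin n) → ℝ≥0∞}
    (hm : LocallyIntegrable m volume) {c : ℝ≥0}
    (h : ∀ ψ : 𝓢(EuclideanSpace ℝ (Fin n), ℂ), ‖∫ x, ψ x * g x‖ₑ ≤ c * ∫⁻ x, ‖ψ x‖ₑ * m x) :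
    ∀ᵐ x, ‖g x‖ₑ ≤ c * m x := by
  have hmt : ∀ᵐ x, m x < ∞ := by
    refine measure_null_of_locally_null _ fun x _ => ?_
    obtain ⟨u, hu, hi⟩ := hm x
    refine ⟨_, inter_mem_nhdsWithin _ hu, ?_⟩
    have h1 : ∀ᵐ y ∂(volume.restrict u), m y < ∞ := by
      have := ae_lt_top' hi.1.aemeasurable (f := m) (by simpa using hi.2.ne)
      exact this
    exact le_antisymm ((Measure.le_restrict_apply _ _).trans h1.le) (zero_le)
  have hmr : LocallyIntegrable (fun x => (m x).toReal) volume := fun x => by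
    obtain ⟨u, hu, hi⟩ := hm x
    exact ⟨u, hu, integrable_toReal_of_lintegral_ne_top hi.1.aemeasurable (by simpa using hi.2.ne)⟩
  let b : ℕ → ContDiffBump (0 : EuclideanSpace ℝ (Fin n)) := fun k =>
    ⟨1 / ((k : ℝ) + 1), 2 * (1 / ((k : ℝ) + 1)), by positivity, by
      have : 0 < 1 / ((k : ℝ) + 1) := by positivity
      linarith⟩
  have hb0 : Tendsto (fun k => (b k).rOut) atTop (𝓝 0) := by
    simpa [b] using (tendsto_one_div_add_atTop_nhds_zero_nat (𝕜 := ℝ)).const_mul 2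
  -- A bounded ratio of radii is what Lebesgue differentiation along bumps requires.
  have hb1 : ∀ᶠ k in atTop, (b k).rOut ≤ 2 * (b k).rIn := Eventually.of_forall fun k => le_rfl
  have hG := ContDiffBump.ae_convolution_tendsto_right_of_locallyIntegrable hb0 hb1 hg
  have hM := ContDiffBump.ae_convolution_tendsto_right_of_locallyIntegrable hb0 hb1 hmr
  filter_upwards [hG, hM, hmt] with x hGx hMx hx
  have key : ∀ k, ‖(MeasureTheory.convolution ((b k).normed volume) g
      (ContinuousLinearMap.lsmul ℝ ℝ) volume) x‖ ≤ c * (MeasureTheory.convolution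
      ((b k).normed volume) (fun x => (m x).toReal) (ContinuousLinearMap.lsmul ℝ ℝ) volume) x := by
    intro k
    rw [convolution_eq_swap, convolution_eq_swap]
    simp only [ContinuousLinearMap.lsmul_apply, Complex.real_smul, ← bumpAt_apply, smul_eq_mul]
    have hc : HasCompactSupport fun y => (b k).normed volume (x - y) :=
      (b k).hasCompactSupport_normed.comp_homeomorph (Homeomorph.subLeft x)
    have hcont : Continuous fun y => (b k).normed volume (x - y) :=
      (b k).continuous_normed.comp (continuous_const.sub continuous_id)
    have hint : Integrable (fun y => (b k).normed volume (x - y) * (m y).toReal) volume :=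
      hmr.integrable_smul_left_of_hasCompactSupport hcont hc
    have hI : ∫⁻ y, ‖bumpAt (b k) x y‖ₑ * m y
        = ENNReal.ofReal (∫ y, (b k).normed volume (x - y) * (m y).toReal) := by
      rw [ofReal_integral_eq_lintegral_ofReal hint (Eventually.of_forall fun y =>
        mul_nonneg ((b k).nonneg_normed _) ENNReal.toReal_nonneg)]
      refine lintegral_congr_ae (hmt.mono fun y hy => ?_)
      dsimp only
      rw [bumpAt_apply, ENNReal.ofReal_mul ((b k).nonneg_normed _), ENNReal.ofReal_toReal hy.ne,
        ← ofReal_norm, Complex.norm_real, Real.norm_of_nonneg ((b k).nonneg_normed _)]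
    have hk := h (bumpAt (b k) x)
    rw [hI, ← ENNReal.ofReal_coe_nnreal, ← ENNReal.ofReal_mul c.coe_nonneg, ← ofReal_norm] at hk
    refine (ENNReal.ofReal_le_ofReal_iff (mul_nonneg c.coe_nonneg (integral_nonneg fun y => ?_))).1 hk
    exact mul_nonneg ((b k).nonneg_normed _) ENNReal.toReal_nonneg
  have hlim := le_of_tendsto_of_tendsto' hGx.norm (hMx.const_mul (c : ℝ)) key
  rw [← ofReal_norm, ← ENNReal.ofReal_toReal hx.ne, ← ENNReal.ofReal_coe_nnreal,
    ← ENNReal.ofReal_mul c.coe_nonneg]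
  exact ENNReal.ofReal_le_ofReal hlim

end Representation

/-! ### The Hardy-Littlewood maximal theorem -/

section MaximalFunction

open Filter Topology

variable {n : ℕ}

/-- The uncentered Hardy-Littlewood maximal function over balls. -/
noncomputable def hlMaximal (u : EuclideanSpace ℝ (Fin n) → ℝ≥0∞)
    (x : EuclideanSpace ℝ (Fin n)) : ℝ≥0∞ :=
  ⨆ (p : EuclideanSpace ℝ (Fin n) × ℝ) (_ : x ∈ Metric.ball p.1 p.2),
    (volume (Metric.ball p.1 p.2))⁻¹ * ∫⁻ y in Metric.ball p.1 p.2, u y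

theorem lt_hlMaximal_iff {u : EuclideanSpace ℝ (Fin n) → ℝ≥0∞} {x : EuclideanSpace ℝ (Fin n)}
    {s : ℝ≥0∞} : s < hlMaximal u x ↔ ∃ p : EuclideanSpace ℝ (Fin n) × ℝ, x ∈ Metric.ball p.1 p.2 ∧
      s < (volume (Metric.ball p.1 p.2))⁻¹ * ∫⁻ y in Metric.ball p.1 p.2, u y := by
  simp only [hlMaximal, lt_iSup_iff, exists_prop]

/-- Since the balls are uncentered, a ball with large average lies entirely in the superlevel set;
no measurability of `u` is needed. -/
theorem isOpen_lt_hlMaximal (u : EuclideanSpace ℝ (Fin n) → ℝ≥0∞) (s : ℝ≥0∞) :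
    IsOpen {x | s < hlMaximal u x} := by
  have : {x | s < hlMaximal u x} = ⋃ p ∈ {p : EuclideanSpace ℝ (Fin n) × ℝ |
      s < (volume (Metric.ball p.1 p.2))⁻¹ * ∫⁻ y in Metric.ball p.1 p.2, u y},
      Metric.ball p.1 p.2 := by
    ext x
    simp only [mem_ofPred_eq, lt_hlMaximal_iff, mem_iUnion, exists_prop, and_comm]
  rw [this]
  exact isOpen_biUnion fun p _ => Metric.isOpen_ball

theorem measurable_hlMaximal (u : EuclideanSpace ℝ (Fin n) → ℝ≥0∞) :
    Measurable (hlMaximal u) :=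
  measurable_of_Ioi fun s => (isOpen_lt_hlMaximal u s).measurableSet

theorem volume_ball_mul (x : EuclideanSpace ℝ (Fin n)) {r : ℝ} (hr : 0 < r) {c : ℝ} (hc : 0 < c) :
    volume (Metric.ball x (c * r)) = ENNReal.ofReal c ^ n * volume (Metric.ball x r) := by
  rw [Measure.addHaar_ball_of_pos _ _ (mul_pos hc hr), Measure.addHaar_ball_of_pos _ _ hr,
    finrank_euclideanSpace_fin, mul_pow, ENNReal.ofReal_mul (by positivity), mul_assoc,
    ENNReal.ofReal_pow hc.le]

/-- The weak type `(1, 1)` inequality. -/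
theorem mul_volume_lt_hlMaximal_le (u : EuclideanSpace ℝ (Fin n) → ℝ≥0∞) (s : ℝ≥0∞) :
    s * volume {x | s < hlMaximal u x} ≤ 5 ^ n * ∫⁻ y, u y := by
  -- Compact subsets are covered by finitely many balls, so the radii are bounded, as Vitali's lemma
  -- demands. Its enlargement factor `5` is the source of `5 ^ n`.
  rw [(isOpen_lt_hlMaximal u s).measure_eq_iSup_isCompact]
  simp_rw [ENNReal.mul_iSup]
  refine iSup₂_le fun K hKO => iSup_le fun hK => ?_
  obtain ⟨t, ht, hKt⟩ := hK.elim_finite_subcover_image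
    (b := {p : EuclideanSpace ℝ (Fin n) × ℝ |
      s < (volume (Metric.ball p.1 p.2))⁻¹ * ∫⁻ y in Metric.ball p.1 p.2, u y})
    (c := fun p => Metric.ball p.1 p.2) (fun p _ => Metric.isOpen_ball) (fun x hx => by
      obtain ⟨p, hp, hs⟩ := lt_hlMaximal_iff.1 (hKO hx)
      exact mem_biUnion hs hp)
  obtain ⟨htf, hKt⟩ := hKt
  obtain ⟨R, hR⟩ := (htf.image Prod.snd).bddAbove
  obtain ⟨v, hvt, hdisj, hcov⟩ := Vitali.exists_disjoint_subfamily_covering_enlargement_ball t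
    Prod.fst Prod.snd R (fun p hp => hR (mem_image_of_mem _ hp)) 5 (by norm_num)
  have hvf : v.Finite := htf.subset hvt
  have hKv : K ⊆ ⋃ p ∈ hvf.toFinset, Metric.ball p.1 (5 * p.2) := fun x hx => by
    obtain ⟨p, hp, hxp⟩ := mem_iUnion₂.1 (hKt hx)
    obtain ⟨q, hq, hpq⟩ := hcov p hp
    exact mem_biUnion (hvf.mem_toFinset.2 hq) (hpq hxp)
  have hball : ∀ p ∈ v, s * volume (Metric.ball p.1 (5 * p.2))
      ≤ 5 ^ n * ∫⁻ y in Metric.ball p.1 p.2, u y := by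
    intro p hp
    rcases le_or_gt p.2 0 with h0 | h0
    · rw [Metric.ball_eq_empty.2 (by linarith)]; simp
    rw [volume_ball_mul _ h0 (by norm_num), mul_left_comm, ENNReal.ofReal_ofNat]
    gcongr
    have hs : s ≤ (volume (Metric.ball p.1 p.2))⁻¹ * ∫⁻ y in Metric.ball p.1 p.2, u y :=
      le_of_lt (ht (hvt hp))
    calc s * volume (Metric.ball p.1 p.2)
        ≤ ((volume (Metric.ball p.1 p.2))⁻¹ * ∫⁻ y in Metric.ball p.1 p.2, u y)
          * volume (Metric.ball p.1 p.2) := by gcongr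
      _ = ∫⁻ y in Metric.ball p.1 p.2, u y := by
        rw [mul_right_comm, ENNReal.inv_mul_cancel (Metric.measure_ball_pos _ _ h0).ne'
          measure_ball_lt_top.ne, one_mul]
  calc s * volume K ≤ s * ∑ p ∈ hvf.toFinset, volume (Metric.ball p.1 (5 * p.2)) := by
        gcongr
        exact (measure_mono hKv).trans (measure_biUnion_finset_le _ _)
    _ ≤ ∑ p ∈ hvf.toFinset, 5 ^ n * ∫⁻ y in Metric.ball p.1 p.2, u y := by
        rw [Finset.mul_sum]
        exact Finset.sum_le_sum fun p hp => hball p (hvf.mem_toFinset.1 hp)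
    _ = 5 ^ n * ∫⁻ y in ⋃ p ∈ hvf.toFinset, Metric.ball p.1 p.2, u y := by
        rw [← Finset.mul_sum, lintegral_biUnion_finset (by simpa using hdisj)
          (fun p _ => measurableSet_ball)]
    _ ≤ 5 ^ n * ∫⁻ y, u y := by
        gcongr
        exact Measure.restrict_le_self

theorem hlMaximal_mono {u v : EuclideanSpace ℝ (Fin n) → ℝ≥0∞} (h : u ≤ v) :
    hlMaximal u ≤ hlMaximal v := fun x => by
  refine iSup₂_mono fun p hp => ?_
  gcongr
  exact h _

theorem hlMaximal_add_le {u v : EuclideanSpace ℝ (Fin n) → ℝ≥0∞} (hu : Measurable u) :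
    hlMaximal (u + v) ≤ hlMaximal u + hlMaximal v := fun x => by
  refine iSup₂_le fun p hp => ?_
  simp only [Pi.add_apply]
  rw [lintegral_add_left hu, mul_add]
  exact add_le_add (le_iSup₂ (f := fun (p : EuclideanSpace ℝ (Fin n) × ℝ)
    (_ : x ∈ Metric.ball p.1 p.2) => (volume (Metric.ball p.1 p.2))⁻¹ *
      ∫⁻ y in Metric.ball p.1 p.2, u y) p hp) (le_iSup₂ (f :=
    fun (p : EuclideanSpace ℝ (Fin n) × ℝ) (_ : x ∈ Metric.ball p.1 p.2) =>
      (volume (Metric.ball p.1 p.2))⁻¹ * ∫⁻ y in Metric.ball p.1 p.2, v y) p hp)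

theorem hlMaximal_const_le (s : ℝ≥0∞) (x : EuclideanSpace ℝ (Fin n)) :
    hlMaximal (fun _ => s) x ≤ s := by
  refine iSup₂_le fun p _ => ?_
  rw [setLIntegral_const, mul_left_comm]
  exact mul_le_of_le_one_right' (ENNReal.inv_mul_le_one _)

/-- The weak type inequality localised to the set where `u` is large. -/
theorem mul_volume_lt_hlMaximal_le_setLIntegral {u : EuclideanSpace ℝ (Fin n) → ℝ≥0∞}
    (hu : Measurable u) {s : ℝ≥0∞} (hs : s ≠ ∞) :
    s * volume {x | 2 * s < hlMaximal u x} ≤ 5 ^ n * ∫⁻ y in {y | s < u y}, u y := by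
  have hms : MeasurableSet {y | s < u y} := measurableSet_lt measurable_const hu
  rw [← lintegral_indicator hms]
  refine le_trans ?_ (mul_volume_lt_hlMaximal_le _ s)
  gcongr s * volume ?_
  intro x hx
  -- The truncated part contributes at most `s` to the maximal function, so a value above `2 * s`
  -- forces the remaining part above `s`.
  have hle : u ≤ (fun _ => s) + {y | s < u y}.indicator u := fun y => by
    by_cases hy : s < u y
    · simp [indicator_of_mem (show y ∈ {y | s < u y} from hy)]
    · simp only [Pi.add_apply]
      exact (not_lt.1 hy).trans le_self_add
  have h1 := (hlMaximal_mono hle x).trans (hlMaximal_add_le measurable_const x)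
  rw [Pi.add_apply] at h1
  have h2 : 2 * s < s + hlMaximal ({y | s < u y}.indicator u) x :=
    hx.trans_le (h1.trans (add_le_add_left (hlMaximal_const_le s x) _))
  rw [two_mul] at h2
  exact (ENNReal.add_lt_add_iff_left hs).1 h2

/-- The layer cake formula at a point. -/
theorem lintegral_Ioi_indicator_rpow {p : ℝ} (hp : 0 < p) (a : ℝ≥0∞) :
    ∫⁻ s in Ioi (0 : ℝ), {s : ℝ | ENNReal.ofReal s < a}.indicator
      (fun s => ENNReal.ofReal (p * s ^ (p - 1))) s = a ^ p := by
  have hfin : ∀ b : ℝ, 0 ≤ b → ∫⁻ s in Ioi (0 : ℝ), (Iio b).indicator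
      (fun s => ENNReal.ofReal (p * s ^ (p - 1))) s = ENNReal.ofReal b ^ p := by
    intro b hb
    rw [setLIntegral_indicator measurableSet_Iio, inter_comm, Ioi_inter_Iio,
      restrict_Ioo_eq_restrict_Ioc, ← ofReal_integral_eq_lintegral_ofReal,
      ← intervalIntegral.integral_of_le hb, intervalIntegral.integral_const_mul,
      integral_rpow (Or.inl (by linarith)), ENNReal.ofReal_rpow_of_nonneg hb hp.le]
    · congr 1
      rw [sub_add_cancel, Real.zero_rpow hp.ne', sub_zero]
      field_simp
    · exact ((intervalIntegral.intervalIntegrable_rpow' (by linarith)).const_mul p).1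
    · filter_upwards [ae_restrict_mem measurableSet_Ioc] with s hs
      exact mul_nonneg hp.le (Real.rpow_nonneg hs.1.le _)
  rcases eq_or_ne a ∞ with rfl | ha
  · rw [ENNReal.top_rpow_of_pos hp]
    refine ENNReal.eq_top_of_forall_nnreal_le fun c => ?_
    have h := hfin ((c : ℝ) ^ (1 / p)) (by positivity)
    rw [ENNReal.ofReal_rpow_of_nonneg (by positivity) hp.le, ← Real.rpow_mul c.coe_nonneg,
      one_div_mul_cancel hp.ne', Real.rpow_one, ENNReal.ofReal_coe_nnreal] at h
    rw [← h]
    refine lintegral_mono fun s => ?_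
    rw [indicator_of_mem (show s ∈ {s : ℝ | ENNReal.ofReal s < ∞} from ENNReal.ofReal_lt_top)]
    exact indicator_le_self _ _ s
  · rw [← ENNReal.ofReal_toReal ha, ← hfin _ ENNReal.toReal_nonneg]
    refine setLIntegral_congr_fun measurableSet_Ioi fun s hs => ?_
    have : s ∈ {s : ℝ | ENNReal.ofReal s < ENNReal.ofReal a.toReal} ↔ s ∈ Iio a.toReal :=
      ENNReal.ofReal_lt_ofReal_iff_of_nonneg (le_of_lt hs)
    by_cases h : s ∈ Iio a.toReal
    · rw [indicator_of_mem h, indicator_of_mem (this.2 h)]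
    · rw [indicator_of_notMem h, indicator_of_notMem (mt this.1 h)]

/-- The layer cake formula, integrated against `w`. -/
theorem lintegral_mul_rpow_eq {α : Type*} [MeasurableSpace α] {μ : Measure α} [SFinite μ]
    {w h : α → ℝ≥0∞} (hw : Measurable w) (hh : Measurable h) {p : ℝ} (hp : 0 < p) :
    ∫⁻ x, w x * h x ^ p ∂μ = ∫⁻ s in Ioi (0 : ℝ), ENNReal.ofReal (p * s ^ (p - 1)) *
      ∫⁻ x in {x | ENNReal.ofReal s < h x}, w x ∂μ := by
  have hset : MeasurableSet {z : α × ℝ | ENNReal.ofReal z.2 < h z.1} :=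
    measurableSet_lt (ENNReal.measurable_ofReal.comp measurable_snd) (hh.comp measurable_fst)
  have hmeas : Measurable (fun z : α × ℝ => {z : α × ℝ | ENNReal.ofReal z.2 < h z.1}.indicator
      (fun z => w z.1 * ENNReal.ofReal (p * z.2 ^ (p - 1))) z) :=
    Measurable.indicator (by fun_prop) hset
  calc ∫⁻ x, w x * h x ^ p ∂μ
      = ∫⁻ x, (∫⁻ s in Ioi (0 : ℝ), {z : α × ℝ | ENNReal.ofReal z.2 < h z.1}.indicator
          (fun z => w z.1 * ENNReal.ofReal (p * z.2 ^ (p - 1))) (x, s)) ∂μ := by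
        refine lintegral_congr fun x => ?_
        rw [← lintegral_Ioi_indicator_rpow hp, ← lintegral_const_mul]
        · refine lintegral_congr fun s => ?_
          by_cases hs : ENNReal.ofReal s < h x
          · rw [indicator_of_mem (show s ∈ {s : ℝ | ENNReal.ofReal s < h x} from hs),
              indicator_of_mem (by exact hs)]
          · rw [indicator_of_notMem (show s ∉ {s : ℝ | ENNReal.ofReal s < h x} from hs),
              indicator_of_notMem (by exact hs), mul_zero]
        · exact Measurable.indicator (by fun_prop)
            (measurableSet_lt ENNReal.measurable_ofReal measurable_const)
    _ = ∫⁻ s in Ioi (0 : ℝ), ∫⁻ x, {z : α × ℝ | ENNReal.ofReal z.2 < h z.1}.indicator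
          (fun z => w z.1 * ENNReal.ofReal (p * z.2 ^ (p - 1))) (x, s) ∂μ :=
        lintegral_lintegral_swap hmeas.aemeasurable
    _ = _ := by
        refine lintegral_congr fun s => ?_
        rw [← lintegral_const_mul _ hw, ← lintegral_indicator
          (measurableSet_lt measurable_const hh)]
        refine lintegral_congr fun x => ?_
        by_cases hs : ENNReal.ofReal s < h x
        · rw [indicator_of_mem (show (x, s) ∈ {z : α × ℝ | ENNReal.ofReal z.2 < h z.1} from hs),
            indicator_of_mem (by exact hs), mul_comm]
        · rw [indicator_of_notMem (show (x, s) ∉ {z : α × ℝ | ENNReal.ofReal z.2 < h z.1} from hs),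
            indicator_of_notMem (by exact hs)]

/-- The strong type `(q, q)` inequality. -/
theorem lintegral_hlMaximal_rpow_le {u : EuclideanSpace ℝ (Fin n) → ℝ≥0∞} (hu : Measurable u)
    {q : ℝ} (hq : 1 < q) :
    ∫⁻ x, hlMaximal u x ^ q ≤
      ENNReal.ofReal (2 ^ q * q / (q - 1)) * 5 ^ n * ∫⁻ x, u x ^ q := by
  have hq0 : 0 < q := by linarith
  have hq1 : 0 < q - 1 := by linarith
  have hMhalf : Measurable fun x => hlMaximal u x / 2 := (measurable_hlMaximal u).div_const 2
  -- Halving matches the level `2 * s` of the localised weak type inequality. Writing `u ^ q = u * u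
  -- ^ (q - 1)` lets the layer cake formula with weight `u` produce the integrals over `{u > s}` on
  -- its right side.
  have h1 : ∫⁻ x, hlMaximal u x ^ q = 2 ^ q * ∫⁻ x, 1 * (hlMaximal u x / 2) ^ q := by
    rw [← lintegral_const_mul _ ((hMhalf.pow_const q).const_mul 1)]
    refine lintegral_congr fun x => ?_
    rw [one_mul, ← ENNReal.mul_rpow_of_nonneg _ _ hq0.le,
      ENNReal.mul_div_cancel two_ne_zero ENNReal.ofNat_ne_top]
  have h2 : ∫⁻ x, u x ^ q = ∫⁻ x, u x * u x ^ (q - 1) := by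
    refine lintegral_congr fun x => ?_
    have := ENNReal.rpow_add_of_nonneg (x := u x) 1 (q - 1) zero_le_one hq1.le
    rwa [add_sub_cancel, ENNReal.rpow_one] at this
  rw [h1, h2, lintegral_mul_rpow_eq measurable_const hMhalf hq0, lintegral_mul_rpow_eq hu hu hq1]
  have h3 : ∀ s ∈ Ioi (0 : ℝ), ENNReal.ofReal (q * s ^ (q - 1)) *
      ∫⁻ x in {x | ENNReal.ofReal s < hlMaximal u x / 2}, 1 ≤
      ENNReal.ofReal (q / (q - 1)) * 5 ^ n * (ENNReal.ofReal ((q - 1) * s ^ (q - 1 - 1)) *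
        ∫⁻ x in {x | ENNReal.ofReal s < u x}, u x) := by
    intro s hs
    have hs0 : 0 < s := hs
    have hw := mul_volume_lt_hlMaximal_le_setLIntegral hu (s := ENNReal.ofReal s)
      ENNReal.ofReal_ne_top
    have hset : {x | ENNReal.ofReal s < hlMaximal u x / 2}
        = {x | 2 * ENNReal.ofReal s < hlMaximal u x} := by
      ext x
      simp only [mem_ofPred_eq]
      rw [ENNReal.lt_div_iff_mul_lt (Or.inl two_ne_zero) (Or.inl ENNReal.ofNat_ne_top), mul_comm]
    rw [setLIntegral_one, hset]
    have e1 : q * s ^ (q - 1) = q * s ^ (q - 1 - 1) * s := by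
      rw [mul_assoc, ← Real.rpow_add_one hs0.ne', sub_add_cancel]
    have e2 : ENNReal.ofReal (q / (q - 1)) * ENNReal.ofReal ((q - 1) * s ^ (q - 1 - 1))
        = ENNReal.ofReal (q * s ^ (q - 1 - 1)) := by
      rw [← ENNReal.ofReal_mul (by positivity)]
      congr 1
      field_simp
    rw [e1, ENNReal.ofReal_mul (by positivity), mul_assoc]
    refine (mul_le_mul_right hw _).trans (le_of_eq ?_)
    rw [← e2]
    ring
  refine (mul_le_mul_right (setLIntegral_mono' measurableSet_Ioi h3) _).trans (le_of_eq ?_)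
  rw [lintegral_const_mul' _ _ (ENNReal.mul_ne_top ENNReal.ofReal_ne_top (by simp)), ← mul_assoc,
    ← mul_assoc]
  congr 2
  rw [mul_div_assoc, ENNReal.ofReal_mul (by positivity), ← ENNReal.ofReal_rpow_of_pos two_pos,
    ENNReal.ofReal_ofNat]

end MaximalFunction

/-! ### Maximal operators on Morrey spaces -/

section MorreyBounds

open Filter Topology

variable {n : ℕ}

theorem exists_lt_abs_sub_of_notMem_cube {a x y : EuclideanSpace ℝ (Fin n)} {ℓ : ℝ}
    (hx : x ∈ cube a ℓ) (hy : y ∉ cube (a - WithLp.toLp 2 fun _ => ℓ) (3 * ℓ)) : ℓ < ‖y - x‖ := by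
  by_contra! h
  refine hy fun i => ?_
  have h1 : |y i - x i| ≤ ℓ := by
    have := PiLp.norm_apply_le (y - x) i
    rw [PiLp.sub_apply, Real.norm_eq_abs] at this
    exact this.trans h
  rw [abs_le] at h1
  have h2 := hx i
  simp only [PiLp.sub_apply]
  constructor <;> linarith [h1.1, h1.2, h2.1, h2.2]

/-- The part of `u` far from a cube contributes a bounded amount to the maximal function. -/
theorem hlMaximal_indicator_compl_le {q lam : ℝ} (hq : 1 ≤ q) (hlam : 0 < lam)
    {u : EuclideanSpace ℝ (Fin n) → ℝ≥0∞} (hu : Measurable u)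
    {a x : EuclideanSpace ℝ (Fin n)} {ℓ : ℝ} (hℓ : 0 < ℓ) (hx : x ∈ cube a ℓ) :
    hlMaximal ((cube (a - WithLp.toLp 2 fun _ => ℓ) (3 * ℓ))ᶜ.indicator u) x ≤
      2 ^ n * (volume (Metric.ball (0 : EuclideanSpace ℝ (Fin n)) 1))⁻¹ *
        (volume (cube a ℓ) ^ (-(1 / lam)) * morreyNorm q lam u) := by
  set Q := cube (a - WithLp.toLp 2 fun _ => ℓ) (3 * ℓ)
  refine iSup₂_le fun p hp => ?_
  rcases (Metric.ball p.1 p.2 ∩ Qᶜ).eq_empty_or_nonempty with he | ⟨y, hyp, hyQ⟩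
  · rw [setLIntegral_indicator (measurableSet_cube _ _).compl, inter_comm, he]
    simp
  -- A ball through `x` that leaves the tripled cube has diameter above `ℓ`, so its circumscribed
  -- cube is larger than `cube a ℓ`.
  have hr : ℓ < 2 * p.2 := by
    have h1 := exists_lt_abs_sub_of_notMem_cube hx hyQ
    rw [← dist_eq_norm] at h1
    have h2 := dist_triangle_right y x p.1
    rw [Metric.mem_ball] at hyp hp
    linarith
  have hr0 : 0 < p.2 := by linarith
  set v := volume (Metric.ball (0 : EuclideanSpace ℝ (Fin n)) 1)
  set b := p.1 - WithLp.toLp 2 fun _ => p.2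
  set T := volume (cube b (2 * p.2)) with hT
  have hT0 : T ≠ 0 := volume_cube_ne_zero _ (by linarith)
  have hTt : T ≠ ∞ := volume_cube_ne_top _ _
  have hV : volume (Metric.ball p.1 p.2) = (2 ^ n)⁻¹ * v * T := by
    rw [Measure.addHaar_ball_of_pos _ _ hr0, finrank_euclideanSpace_fin, hT, volume_cube,
      ENNReal.ofReal_mul zero_le_two, ENNReal.ofReal_pow hr0.le, mul_pow, ENNReal.ofReal_ofNat]
    calc ENNReal.ofReal p.2 ^ n * v = ((2 ^ n)⁻¹ * 2 ^ n) * (ENNReal.ofReal p.2 ^ n * v) := by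
          rw [ENNReal.inv_mul_cancel (by simp) (by simp), one_mul]
      _ = _ := by ring
  have hVinv : (volume (Metric.ball p.1 p.2))⁻¹ = 2 ^ n * v⁻¹ * T⁻¹ := by
    rw [hV, ENNReal.mul_inv (Or.inr hTt) (Or.inr hT0), ENNReal.mul_inv (Or.inl (by simp))
      (Or.inl (by simp)), inv_inv]
  have hint : ∫⁻ y in Metric.ball p.1 p.2, Qᶜ.indicator u y
      ≤ T ^ (1 - 1 / lam) * morreyNorm q lam u := by
    refine le_trans (lintegral_mono (indicator_le_self _ _)) ?_
    refine (lintegral_mono_set (ball_subset_cube p.1 p.2)).trans ?_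
    have := setLIntegral_cube_le (lam := lam) hq hu.aestronglyMeasurable b
      (show 0 < 2 * p.2 by linarith)
    simpa only [enorm_eq_self] using this
  rw [hVinv, mul_assoc]
  gcongr _ * ?_
  refine (mul_le_mul_right hint _).trans ?_
  rw [← mul_assoc, ← ENNReal.rpow_neg_one, ← ENNReal.rpow_add _ _ hT0 hTt]
  gcongr
  -- The exponent is negative, so the larger volume `T` may be replaced by that of `cube a ℓ`.
  have e : -1 + (1 - 1 / lam) = -(1 / lam) := by ring
  rw [e, ENNReal.rpow_neg, ENNReal.rpow_neg]
  gcongr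
  rw [hT, volume_cube, volume_cube]
  gcongr

/-- The Hardy-Littlewood maximal operator is bounded on Morrey spaces. -/
theorem exists_morreyNorm_hlMaximal_le (n : ℕ) {q lam : ℝ} (hq : 1 < q) (hlam : 0 < lam) :
    ∃ C : ℝ≥0, ∀ u : EuclideanSpace ℝ (Fin n) → ℝ≥0∞, Measurable u →
      morreyNorm q lam (hlMaximal u) ≤ C * morreyNorm q lam u := by
  have hq0 : 0 < q := by linarith
  set A : ℝ≥0∞ := ENNReal.ofReal (2 ^ q * q / (q - 1)) * 5 ^ n with hA
  set D : ℝ≥0∞ := 2 ^ n * (volume (Metric.ball (0 : EuclideanSpace ℝ (Fin n)) 1))⁻¹ with hD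
  -- `S` is the cost of replacing the Morrey weight of a cube by that of its triple.
  set S : ℝ≥0∞ := (3 ^ n) ^ (1 / q - 1 / lam) with hS
  have hAt : A ≠ ∞ := ENNReal.mul_ne_top ENNReal.ofReal_ne_top (by simp)
  have hDt : D ≠ ∞ := ENNReal.mul_ne_top (by simp)
    (ENNReal.inv_ne_top.2 (Metric.measure_ball_pos _ _ one_pos).ne')
  have hSt : S ≠ ∞ := by
    rw [hS, Ne, ENNReal.rpow_eq_top_iff]
    simp
  have hCt : S * A ^ (1 / q) + D ≠ ∞ := ENNReal.add_ne_top.2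
    ⟨ENNReal.mul_ne_top hSt (ENNReal.rpow_ne_top_of_nonneg (by positivity) hAt), hDt⟩
  refine ⟨(S * A ^ (1 / q) + D).toNNReal, fun u hu => ?_⟩
  rw [ENNReal.coe_toNNReal hCt]
  refine iSup₂_le fun a ℓ => iSup_le fun hℓ => ?_
  simp only [enorm_eq_self]
  set Q := cube a ℓ
  set Q' := cube (a - WithLp.toLp 2 fun _ => ℓ) (3 * ℓ) with hQ'
  set N := morreyNorm q lam u with hN
  have hQ0 : volume Q ≠ 0 := volume_cube_ne_zero a hℓ
  have hQt : volume Q ≠ ∞ := volume_cube_ne_top a ℓ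
  have hQQ' : volume Q' = 3 ^ n * volume Q := by
    rw [hQ', volume_cube, volume_cube, ENNReal.ofReal_mul (by norm_num), mul_pow,
      ENNReal.ofReal_ofNat]
  have hu1 : Measurable (Q'.indicator u) := hu.indicator (measurableSet_cube _ _)
  have hle : ∀ x ∈ Q, hlMaximal u x ≤ hlMaximal (Q'.indicator u) x +
      D * (volume Q ^ (-(1 / lam)) * N) := by
    intro x hx
    have h1 := hlMaximal_add_le (v := Q'ᶜ.indicator u) hu1 x
    rw [indicator_self_add_compl] at h1
    refine h1.trans ?_
    rw [Pi.add_apply]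
    gcongr
    exact hlMaximal_indicator_compl_le hq.le hlam hu hℓ hx
  have h1 : (∫⁻ y in Q, hlMaximal u y ^ q) ^ (1 / q) ≤
      (∫⁻ y in Q, hlMaximal (Q'.indicator u) y ^ q) ^ (1 / q) +
        D * (volume Q ^ (-(1 / lam)) * N) * volume Q ^ (1 / q) := by
    refine (ENNReal.rpow_le_rpow (setLIntegral_mono' (measurableSet_cube a ℓ) fun y hy =>
      ENNReal.rpow_le_rpow (hle y hy) hq0.le) (by positivity)).trans ?_
    refine (ENNReal.lintegral_Lp_add_le (f := hlMaximal (Q'.indicator u))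
      (g := fun _ => D * (volume Q ^ (-(1 / lam)) * N))
      (measurable_hlMaximal _).aemeasurable aemeasurable_const hq.le).trans (le_of_eq ?_)
    rw [setLIntegral_const, ENNReal.mul_rpow_of_nonneg _ _ (show 0 ≤ 1 / q by positivity),
      ← ENNReal.rpow_mul, mul_one_div_cancel hq0.ne', ENNReal.rpow_one]
  have h2 : (∫⁻ y in Q, hlMaximal (Q'.indicator u) y ^ q) ^ (1 / q) ≤
      A ^ (1 / q) * (∫⁻ y in Q', u y ^ q) ^ (1 / q) := by
    rw [← ENNReal.mul_rpow_of_nonneg _ _ (show 0 ≤ 1 / q by positivity)]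
    refine ENNReal.rpow_le_rpow ?_ (by positivity)
    refine (setLIntegral_le_lintegral _ _).trans ((lintegral_hlMaximal_rpow_le hu1 hq).trans ?_)
    rw [← lintegral_indicator (measurableSet_cube _ _)]
    refine mul_le_mul_right (lintegral_mono fun y => ?_) _
    by_cases hy : y ∈ Q'
    · rw [indicator_of_mem hy, indicator_of_mem hy]
    · rw [indicator_of_notMem hy, indicator_of_notMem hy, ENNReal.zero_rpow_of_pos hq0]
  have h3 : volume Q ^ (1 / lam - 1 / q) = S * volume Q' ^ (1 / lam - 1 / q) := by
    rw [hQQ', ENNReal.mul_rpow_of_ne_top (by simp) hQt, hS, ← mul_assoc,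
      ← ENNReal.rpow_add _ _ (by simp) (by simp)]
    have : 1 / q - 1 / lam + (1 / lam - 1 / q) = 0 := by ring
    rw [this, ENNReal.rpow_zero, one_mul]
  have h4 : volume Q' ^ (1 / lam - 1 / q) * (∫⁻ y in Q', u y ^ q) ^ (1 / q) ≤ N := by
    have h : 0 < 3 * ℓ := by linarith
    refine le_trans (le_of_eq ?_)
      (le_morreyNorm q lam u (a - WithLp.toLp 2 fun _ => ℓ) h)
    simp only [enorm_eq_self, hQ']
  have h5 : volume Q ^ (1 / lam - 1 / q) * (volume Q ^ (-(1 / lam)) * volume Q ^ (1 / q)) = 1 := by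
    rw [← ENNReal.rpow_add _ _ hQ0 hQt, ← ENNReal.rpow_add _ _ hQ0 hQt]
    have : 1 / lam - 1 / q + (-(1 / lam) + 1 / q) = 0 := by ring
    rw [this, ENNReal.rpow_zero]
  calc volume Q ^ (1 / lam - 1 / q) * (∫⁻ y in Q, hlMaximal u y ^ q) ^ (1 / q)
      ≤ volume Q ^ (1 / lam - 1 / q) * (A ^ (1 / q) * (∫⁻ y in Q', u y ^ q) ^ (1 / q) +
        D * (volume Q ^ (-(1 / lam)) * N) * volume Q ^ (1 / q)) := by
        gcongr
        exact h1.trans (add_le_add_left h2 _)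
    _ = S * A ^ (1 / q) * (volume Q' ^ (1 / lam - 1 / q) * (∫⁻ y in Q', u y ^ q) ^ (1 / q)) +
        (volume Q ^ (1 / lam - 1 / q) * (volume Q ^ (-(1 / lam)) * volume Q ^ (1 / q))) * D * N := by
        rw [mul_add]
        congr 1
        · rw [h3]; ring
        · ring
    _ ≤ S * A ^ (1 / q) * N + 1 * D * N := by
        rw [h5]
        gcongr
    _ = (S * A ^ (1 / q) + D) * N := by ring

/-- The smooth maximal function is dominated by the Hardy-Littlewood maximal function. -/
theorem exists_maximal_le_hlMaximal (φ : 𝓢(EuclideanSpace ℝ (Fin n), ℂ)) :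
    ∃ C : ℝ≥0, ∀ (f : 𝓢'(EuclideanSpace ℝ (Fin n), ℂ)) (g : EuclideanSpace ℝ (Fin n) → ℂ)
      (u : EuclideanSpace ℝ (Fin n) → ℝ≥0∞), IsRepresentedBy f g → Measurable u →
      (∀ᵐ y, ‖g y‖ₑ ≤ u y) → ∀ x, maximal φ f x ≤ C * hlMaximal u x := by
  obtain ⟨D, hD, hφ⟩ := exists_decay_iteratedFDeriv φ (n + 1) 0
  set v := volume (Metric.ball (0 : EuclideanSpace ℝ (Fin n)) 1) with hv
  have hCt : ENNReal.ofReal D * (2 ^ (n + 2) * v) ≠ ∞ :=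
    ENNReal.mul_ne_top ENNReal.ofReal_ne_top (ENNReal.mul_ne_top (by simp) measure_ball_lt_top.ne)
  refine ⟨(ENNReal.ofReal D * (2 ^ (n + 2) * v)).toNNReal, fun f g u hfg hu hgu x => ?_⟩
  rw [ENNReal.coe_toNNReal hCt]
  refine iSup₂_le fun t ht => ?_
  have htn : 0 < t ^ n := by positivity
  have hpt : ∀ y, ‖dilate φ ht x y‖ₑ ≤ ENNReal.ofReal (t ^ n)⁻¹ * (ENNReal.ofReal D *
      ENNReal.ofReal ((1 + ‖t⁻¹ • (x - y)‖) ^ (n + 1))⁻¹) := by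
    intro y
    rw [dilate_apply, ← ENNReal.ofReal_mul hD, ← ENNReal.ofReal_mul (by positivity), ← ofReal_norm,
      norm_smul, Real.norm_of_nonneg (by positivity)]
    refine ENNReal.ofReal_le_ofReal ?_
    gcongr
    have := hφ (t⁻¹ • (x - y))
    rw [norm_iteratedFDeriv_zero] at this
    rw [← div_eq_mul_inv, le_div_iff₀ (by positivity), mul_comm]
    exact this
  -- Averages over `ball x (2 ^ k * t)` are at most `hlMaximal u x`; the factor `t ^ n` in `A`
  -- cancels the normalization of `φ_t`.
  have hdecay := lintegral_decay_mul_le (μ := volume) hu.aemeasurable x ht n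
    (A := ENNReal.ofReal t ^ n * v * hlMaximal u x) fun k => by
      have h0 : 0 < (2 : ℝ) ^ k * t := by positivity
      have hb : (volume (Metric.ball x (2 ^ k * t)))⁻¹ * ∫⁻ y in Metric.ball x (2 ^ k * t), u y
          ≤ hlMaximal u x :=
        le_iSup₂ (f := fun (p : EuclideanSpace ℝ (Fin n) × ℝ) (_ : x ∈ Metric.ball p.1 p.2) =>
          (volume (Metric.ball p.1 p.2))⁻¹ * ∫⁻ y in Metric.ball p.1 p.2, u y)
          (x, 2 ^ k * t) (Metric.mem_ball_self h0)
      rw [ENNReal.inv_mul_le_iff (Metric.measure_ball_pos _ _ h0).ne' measure_ball_lt_top.ne] at hb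
      refine hb.trans (le_of_eq ?_)
      rw [Measure.addHaar_ball_of_pos _ _ h0, finrank_euclideanSpace_fin, ENNReal.ofReal_pow h0.le,
        ENNReal.ofReal_mul (by positivity), ENNReal.ofReal_pow zero_le_two, ENNReal.ofReal_ofNat,
        mul_pow, pow_right_comm]
      ring
  calc ‖conv φ ht f x‖ₑ ≤ ∫⁻ y, ‖dilate φ ht x y * g y‖ₑ := by
        rw [conv, (hfg _).2]
        exact enorm_integral_le_lintegral_enorm _
    _ ≤ ∫⁻ y, (ENNReal.ofReal (t ^ n)⁻¹ * ENNReal.ofReal D) *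
          (ENNReal.ofReal ((1 + ‖t⁻¹ • (x - y)‖) ^ (n + 1))⁻¹ * u y) := by
        refine lintegral_mono_ae (hgu.mono fun y hy => ?_)
        rw [enorm_mul, ← mul_assoc, mul_assoc (ENNReal.ofReal (t ^ n)⁻¹)]
        exact mul_le_mul' (hpt y) hy
    _ ≤ (ENNReal.ofReal (t ^ n)⁻¹ * ENNReal.ofReal D) *
          (2 ^ (n + 2) * (ENNReal.ofReal t ^ n * v * hlMaximal u x)) := by
        rw [lintegral_const_mul' _ _ (ENNReal.mul_ne_top ENNReal.ofReal_ne_top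
          ENNReal.ofReal_ne_top)]
        gcongr
    _ = (ENNReal.ofReal (t ^ n)⁻¹ * ENNReal.ofReal (t ^ n)) *
          (ENNReal.ofReal D * (2 ^ (n + 2) * v) * hlMaximal u x) := by
        rw [ENNReal.ofReal_pow ht.le]; ring
    _ = ENNReal.ofReal D * (2 ^ (n + 2) * v) * hlMaximal u x := by
        rw [← ENNReal.ofReal_mul (by positivity), inv_mul_cancel₀ htn.ne', ENNReal.ofReal_one,
          one_mul]

theorem exists_hardyMorreyNorm_le (φ : 𝓢(EuclideanSpace ℝ (Fin n), ℂ)) {q lam : ℝ} (hq : 1 < q)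
    (hlam : 0 < lam) :
    ∃ C : ℝ≥0, 0 < C ∧ ∀ (f : 𝓢'(EuclideanSpace ℝ (Fin n), ℂ))
      (g : EuclideanSpace ℝ (Fin n) → ℂ), IsRepresentedBy f g →
      hardyMorreyNorm φ q lam f ≤ C * morreyNorm q lam g := by
  obtain ⟨C₁, h₁⟩ := exists_maximal_le_hlMaximal φ
  obtain ⟨C₂, h₂⟩ := exists_morreyNorm_hlMaximal_le n hq hlam
  have hq0 : 0 < q := by linarith
  -- The added `1` only makes the constant positive, so that it can be inverted.
  refine ⟨C₁ * C₂ + 1, by positivity, fun f g hfg => ?_⟩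
  have hg := hfg.locallyIntegrable.aestronglyMeasurable
  -- The maximal inequalities require a Borel function, so `g` is replaced by a measurable
  -- representative.
  let u : EuclideanSpace ℝ (Fin n) → ℝ≥0∞ := fun y => ‖hg.mk g y‖ₑ
  have hu : Measurable u := hg.stronglyMeasurable_mk.enorm
  have hgu : ∀ᵐ y, ‖g y‖ₑ = u y := hg.ae_eq_mk.mono fun y hy => congrArg _ hy
  calc hardyMorreyNorm φ q lam f ≤ C₁ * morreyNorm q lam (hlMaximal u) :=
        morreyNorm_le_of_ae_le hq0 (Eventually.of_forall fun x => by
          simpa only [enorm_eq_self] using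
            h₁ f g u hfg hu (hgu.mono fun y hy => hy.le) x)
    _ ≤ C₁ * (C₂ * (((1 : ℝ≥0) : ℝ≥0∞) * morreyNorm q lam g)) := by
        gcongr
        refine (h₂ u hu).trans ?_
        gcongr
        exact morreyNorm_le_of_ae_le hq0 (hgu.mono fun y hy => by simp [hy])
    _ = (C₁ * C₂) * morreyNorm q lam g := by rw [ENNReal.coe_one, one_mul, mul_assoc]
    _ ≤ ((C₁ * C₂ + 1 : ℝ≥0) : ℝ≥0∞) * morreyNorm q lam g := by
        gcongr
        push_cast
        exact le_self_add

end MorreyBounds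

/-! ### Comparison of the Morrey and Hardy-Morrey spaces -/

section Equivalence

open Filter Topology

variable {n : ℕ}

theorem enorm_apply_le_inv_mul {φ : 𝓢(EuclideanSpace ℝ (Fin n), ℂ)} (hφ : (∫ x, φ x) ≠ 0)
    (f : 𝓢'(EuclideanSpace ℝ (Fin n), ℂ)) (ψ : 𝓢(EuclideanSpace ℝ (Fin n), ℂ)) :
    ‖f ψ‖ₑ ≤ (‖∫ x, φ x‖₊⁻¹ : ℝ≥0) * ∫⁻ x, ‖ψ x‖ₑ * maximal φ f x := by
  have h0 : ‖∫ x, φ x‖₊ ≠ 0 := nnnorm_ne_zero_iff.2 hφ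
  have h := enorm_integral_mul_enorm_apply_le φ ψ f
  rw [ENNReal.coe_inv h0, ← ENNReal.mul_le_iff_le_inv (by simpa using h0) ENNReal.coe_ne_top]
  exact h

/-- Finiteness of the right side is not assumed: it is trivial when infinite. The bound is therefore
available for every admissible `φ` once `f` is known to be a function. -/
theorem morreyNorm_le_hardyMorreyNorm {φ : 𝓢(EuclideanSpace ℝ (Fin n), ℂ)}
    (hφ : (∫ x, φ x) ≠ 0) {q lam : ℝ} (hq : 1 ≤ q) (hlam : 1 ≤ lam)
    {f : 𝓢'(EuclideanSpace ℝ (Fin n), ℂ)} {g : EuclideanSpace ℝ (Fin n) → ℂ}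
    (hfg : IsRepresentedBy f g) :
    morreyNorm q lam g ≤ (‖∫ x, φ x‖₊⁻¹ : ℝ≥0) * hardyMorreyNorm φ q lam f := by
  have h0 : ‖∫ x, φ x‖₊⁻¹ ≠ 0 := inv_ne_zero (nnnorm_ne_zero_iff.2 hφ)
  rcases eq_or_ne (hardyMorreyNorm φ q lam f) ∞ with htop | htop
  · rw [htop, ENNReal.mul_top (by exact_mod_cast h0)]
    exact le_top
  have hm := locallyIntegrable_of_morreyNorm_lt_top hq hlam
    (measurable_maximal φ f).aestronglyMeasurable (lt_top_iff_ne_top.2 htop)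
  have hae := ae_enorm_le_of_forall_enorm_integral_le hfg.locallyIntegrable hm fun ψ => by
    rw [← (hfg ψ).2]
    exact enorm_apply_le_inv_mul hφ f ψ
  exact morreyNorm_le_of_ae_le (by linarith) (hae.mono fun x hx => by
    simpa only [enorm_eq_self] using hx)

theorem MemHardyMorrey.exists_memMorrey {q lam : ℝ} (hq : 1 ≤ q) (hlam : 1 ≤ lam)
    {f : 𝓢'(EuclideanSpace ℝ (Fin n), ℂ)} (hf : MemHardyMorrey q lam f) :
    ∃ g, MemMorrey q lam g ∧ IsRepresentedBy f g := by
  obtain ⟨φ, hφ, -, hN⟩ := hf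
  have hfin := lintegral_decay_mul_enorm_lt_top hq hlam
    (measurable_maximal φ f).aestronglyMeasurable hN
  simp only [enorm_eq_self] at hfin
  obtain ⟨g, hg⟩ := exists_isRepresentedBy (measurable_maximal φ f) hfin
    (enorm_apply_le_inv_mul hφ f)
  exact ⟨g, ⟨hg.locallyIntegrable, (morreyNorm_le_hardyMorreyNorm hφ hq hlam hg).trans_lt
    (ENNReal.mul_lt_top ENNReal.coe_lt_top hN)⟩, hg⟩

theorem MemMorrey.exists_isRepresentedBy {q lam : ℝ} (hq : 1 ≤ q) (hlam : 1 ≤ lam)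
    {g : EuclideanSpace ℝ (Fin n) → ℂ} (hg : MemMorrey q lam g) :
    ∃ f : 𝓢'(EuclideanSpace ℝ (Fin n), ℂ), IsRepresentedBy f g := by
  have hgm := hg.1.aestronglyMeasurable
  have hfin := lintegral_decay_mul_enorm_lt_top hq hlam hgm hg.2
  have hwi : Integrable (fun y => ((1 + ‖y‖) ^ (n + 1))⁻¹ * ‖g y‖) volume := by
    refine ⟨by fun_prop, ?_⟩
    refine lt_of_eq_of_lt (lintegral_congr fun y => ?_) hfin
    rw [enorm_mul, enorm_norm, ← ofReal_norm, Real.norm_of_nonneg (by positivity)]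
  set p : Seminorm ℂ 𝓢(EuclideanSpace ℝ (Fin n), ℂ) :=
    (Finset.Iic (n + 1, 0)).sup (fun m => SchwartzMap.seminorm ℂ m.1 m.2) with hp
  have hpt : ∀ (ψ : 𝓢(EuclideanSpace ℝ (Fin n), ℂ)) y, ‖ψ y * g y‖ ≤
      2 ^ (n + 1) * p ψ * (((1 + ‖y‖) ^ (n + 1))⁻¹ * ‖g y‖) := by
    intro ψ y
    have := one_add_le_sup_seminorm_apply (𝕜 := ℂ) (m := (n + 1, 0)) (k := n + 1) (n := 0)
      le_rfl le_rfl ψ y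
    rw [norm_iteratedFDeriv_zero] at this
    rw [norm_mul, ← mul_assoc, ← div_eq_mul_inv]
    gcongr
    rw [le_div_iff₀ (by positivity), mul_comm]
    exact this
  have hint : ∀ ψ : 𝓢(EuclideanSpace ℝ (Fin n), ℂ), Integrable (fun y => ψ y * g y) volume :=
    fun ψ => (hwi.const_mul (2 ^ (n + 1) * p ψ)).mono'
      (ψ.continuous.aestronglyMeasurable.mul hgm) (Eventually.of_forall (hpt ψ))
  let f : 𝓢(EuclideanSpace ℝ (Fin n), ℂ) →L[ℂ] ℂ :=
    mkCLMtoNormedSpace (fun ψ => ∫ y, ψ y * g y)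
      (fun ψ η => by
        rw [← integral_add (hint ψ) (hint η)]
        exact integral_congr_ae (Eventually.of_forall fun y => by simp [add_mul]))
      (fun c ψ => by
        simp [mul_assoc, integral_const_mul])
      ⟨Finset.Iic (n + 1, 0), 2 ^ (n + 1) * ∫ y, ((1 + ‖y‖) ^ (n + 1))⁻¹ * ‖g y‖,
        mul_nonneg (by positivity) (integral_nonneg fun y => by positivity), fun ψ => by
          refine (norm_integral_le_of_norm_le (hwi.const_mul (2 ^ (n + 1) * p ψ))
            (Eventually.of_forall (hpt ψ))).trans (le_of_eq ?_)
          rw [integral_const_mul, mul_right_comm]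
          rfl⟩
  exact ⟨ContinuousLinearMap.toPointwiseConvergenceCLM ℂ _ _ _ f, fun ψ => ⟨hint ψ, rfl⟩⟩

theorem IsRepresentedBy.memHardyMorrey {q lam : ℝ} (hq : 1 < q) (hlam : 1 ≤ lam)
    {f : 𝓢'(EuclideanSpace ℝ (Fin n), ℂ)} {g : EuclideanSpace ℝ (Fin n) → ℂ}
    (hfg : IsRepresentedBy f g) (hg : MemMorrey q lam g) : MemHardyMorrey q lam f := by
  obtain ⟨φ, hφ⟩ := exists_integral_ne_zero (n := n)
  obtain ⟨C, -, hC⟩ := exists_hardyMorreyNorm_le φ hq (zero_lt_one.trans_le hlam)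
  have hN : morreyNorm q lam (maximal φ f) < ∞ :=
    (hC f g hfg).trans_lt (ENNReal.mul_lt_top ENNReal.coe_lt_top hg.2)
  exact ⟨φ, hφ, locallyIntegrable_of_morreyNorm_lt_top hq.le hlam
    (measurable_maximal φ f).aestronglyMeasurable hN, hN⟩

end Equivalence

end HardyMorrey

theorem proposition2p6 (n : ℕ) :
    (∀ q lam : ℝ, 1 < q → q ≤ lam →
      (∀ g : EuclideanSpace ℝ (Fin n) → ℂ, MemMorrey q lam g →
        ∃ f : 𝓢'(EuclideanSpace ℝ (Fin n), ℂ), IsRepresentedBy f g) ∧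
      (∀ f : 𝓢'(EuclideanSpace ℝ (Fin n), ℂ),
        MemHardyMorrey q lam f ↔ ∃ g, MemMorrey q lam g ∧ IsRepresentedBy f g) ∧
      (∀ φ : 𝓢(EuclideanSpace ℝ (Fin n), ℂ), (∫ x, φ x) ≠ 0 →
        ∃ c₁ c₂ : ℝ≥0, 0 < c₁ ∧ 0 < c₂ ∧
          ∀ (f : 𝓢'(EuclideanSpace ℝ (Fin n), ℂ)) (g : EuclideanSpace ℝ (Fin n) → ℂ),
            MemMorrey q lam g → IsRepresentedBy f g →
              c₁ * hardyMorreyNorm φ q lam f ≤ morreyNorm q lam g ∧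
              morreyNorm q lam g ≤ c₂ * hardyMorreyNorm φ q lam f)) ∧
    (∀ lam : ℝ, 1 ≤ lam →
      ∀ φ : 𝓢(EuclideanSpace ℝ (Fin n), ℂ), (∫ x, φ x) ≠ 0 →
        ∃ C : ℝ≥0, 0 < C ∧
          ∀ f : 𝓢'(EuclideanSpace ℝ (Fin n), ℂ), MemHardyMorrey 1 lam f →
            ∃ g : EuclideanSpace ℝ (Fin n) → ℂ, MemMorrey 1 lam g ∧ IsRepresentedBy f g ∧
              morreyNorm 1 lam g ≤ C * hardyMorreyNorm φ 1 lam f) := by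
  have hpos : ∀ φ : 𝓢(EuclideanSpace ℝ (Fin n), ℂ), (∫ x, φ x) ≠ 0 → 0 < ‖∫ x, φ x‖₊⁻¹ :=
    fun φ hφ => inv_pos.2 (nnnorm_pos.2 hφ)
  refine ⟨fun q lam hq hqlam => ?_, fun lam hlam φ hφ => ?_⟩
  · have hlam : 1 ≤ lam := hq.le.trans hqlam
    refine ⟨fun g hg => hg.exists_isRepresentedBy hq.le hlam, fun f =>
      ⟨fun hf => hf.exists_memMorrey hq.le hlam, fun ⟨g, hg, hfg⟩ => hfg.memHardyMorrey hq hlam hg⟩,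
      fun φ hφ => ?_⟩
    obtain ⟨C, hC, h⟩ := exists_hardyMorreyNorm_le φ hq (zero_lt_one.trans_le hlam)
    refine ⟨C⁻¹, ‖∫ x, φ x‖₊⁻¹, inv_pos.2 hC, hpos φ hφ, fun f g _ hfg =>
      ⟨?_, morreyNorm_le_hardyMorreyNorm hφ hq.le hlam hfg⟩⟩
    rw [ENNReal.coe_inv hC.ne', ENNReal.inv_mul_le_iff (by exact_mod_cast hC.ne')
      ENNReal.coe_ne_top]
    exact h f g hfg
  · refine ⟨‖∫ x, φ x‖₊⁻¹, hpos φ hφ, fun f hf => ?_⟩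
    -- The function `g` comes from whichever test function witnesses membership; the estimate then
    -- holds for the prescribed `φ`, since it only uses that `g` represents `f`.
    obtain ⟨g, hg, hfg⟩ := hf.exists_memMorrey le_rfl hlam
    exact ⟨g, hg, hfg, morreyNorm_le_hardyMorreyNorm hφ le_rfl hlam hfg⟩
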